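/- Let $X$ be a right-continuous continuous-time Markov chain with left limits on a probability space $(\Omega,\mathcal F,\mathbb P)$, with states the standard basis vectors $e_1,\dots,e_N$ of $\mathbb R^N$, deterministic initial state $X_0$, and measurable, uniformly bounded, time-dependent rate matrix $A_t$, where $(A_t)_{ij}$ is the rate of jumping from $e_j$ to $e_i$ (so $(A_t)_{ij}\ge 0$ for $i\ne j$ and all column sums are $0$). That is, $M_t = X_t - X_0-\int_{]0,t]}A_sX_{s-}\,ds$ is a martingale for the filtration $\mathcal F_t$ generated by $X$ and the null sets of $\mathcal F$. Assume $\mathbb P(X_t=e_i)>0$ for all $t>0$ and all $i$. For predictable $\mathbb R^N$-valued processes write $Z\sim_M Z'$ if $(Z_t-Z_t')^*\Psi_t(Z_t-Z_t')=0$ $dt\times d\mathbb P$-a.e., where $\Psi_t=\mathrm{diag}(A_tX_{t-})-A_t\,\mathrm{diag}(X_{t-})-\mathrm{diag}(X_{t-})A_t^*$. Let $f:\Omega\times\mathbb R^+\times\mathbb R\times\mathbb R^N\to\mathbb R$ be progressively measurable and invariant under $\sim_M$: if $Z\sim_M Z'$ are predictable, then for $dt\times d\mathbb P$-almost every $(t,\omega)$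 one has $f(\omega,t,y,Z_t)=f(\omega,t,y,Z'_t)$ for all $y\in\mathbb R$. Let $T\in[0,\infty]$; below, all times are finite and at most $T$. Let $Y$ be adapted with $E[\sup_{t<S}Y_t^2]<\infty$ for every finite $S\le T$, let $Z$ be predictable, and suppose that \[dY_t=-f(\omega,t,Y_{t-},Z_t)\,dt+Z_t^*\,dM_t ,\] where $\int_0^t|f(\omega,s,Y_{s-},Z_s)|\,ds$ and $\int_0^t|Z_s^*A_sX_{s-}|\,ds$ are a.s. finite for all $t$, and $\int Z^*dM$ is the pathwise integral. Suppose that $Y$ is Markovian: up to indistinguishability $Y_t=u(t,X_t)$ for some deterministic function $u$. Then $f$ is Markovian along the solution: there is a function $\tilde f:\mathbb R^N\times\mathbb R^+\times\mathbb R\times\mathbb R^N\to\mathbb R$ such that \[f(\omega,t,Y_t,Z_t)=\tilde f(X_t,t,Y_t,Z_t)\qquad dt\times d\mathbb P\text{-a.e.},\] where, as $Z$ is only determined up to $\sim_M$, this identity is required with every predictable $Z'\sim_M Z$ in place of $Z$. Moreover, for every such $\tilde f$, the vector $\mathbf u_t=(u(t,e_i))_{i}$ satisfies on $t>0$ the coupled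 system of ordinary differential equations \[d\mathbf u_t=-\bigl(\mathbf f(t,\mathbf u_t)+A_t^*\mathbf u_t\bigr)\,dt,\qquad e_i^*\mathbf f(t,\mathbf u):=\tilde f(e_i,t,e_i^*\mathbf u,\mathbf u),\] in the sense that for all $0<s\le t$ the right-hand side is integrable on $]s,t]$ and its integral is $\mathbf u_t-\mathbf u_s$. For the component $i$ with $X_0=e_i$ this holds also with $s=0$. (For $e_i\neq X_0$ the value $u(0,e_i)$ is not determined by $Y$.) -/

import Mathlib

open MeasureTheory Filter Topology Function
open scoped NNReal ENNReal Matrix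

namespace MarkovBSDE

noncomputable section

/-- Lebesgue measure on the time axis `[0, ∞)`. -/
def leb : Measure ℝ≥0 := Measure.comap ((↑) : ℝ≥0 → ℝ) volume

/-- The basis vector `e i` of `ℝ^N`, representing the `i`-th state. -/
def e {N : ℕ} (i : Fin N) : Fin N → ℝ := Pi.single i 1

/-- `A t i j` is the rate of jumping from state `j` to state `i` at time `t`. The rates depend
measurably on time and are uniformly bounded; the columns sum to zero. -/
structure IsRateMatrix {N : ℕ} (A : ℝ≥0 → Matrix (Fin N) (Fin N) ℝ) : Prop where
  measurable : ∀ i j, Measurable fun t => A t i j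
  bounded : ∃ C : ℝ, ∀ t i j, |A t i j| ≤ C
  nonneg : ∀ t i j, i ≠ j → 0 ≤ A t i j
  col_sum : ∀ t j, ∑ i, A t i j = 0

/-- The value `x_{t-}` of a path just before time `t` (and `x_{0-} = x_0`). -/
def pre {E : Type*} [TopologicalSpace E] (x : ℝ≥0 → E) (t : ℝ≥0) : E := leftLim x t

section Chain

variable {N : ℕ} {Ω : Type*} [mΩ : MeasurableSpace Ω]

/-- The filtration `ℱ_t = σ(X_s, s ≤ t) ∨ {A ∈ ℱ : P A = 0}`. -/
def chainFiltration (P : Measure Ω) (X : ℝ≥0 → Ω → Fin N → ℝ) (hX : ∀ t, Measurable (X t)) :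
    Filtration ℝ≥0 mΩ where
  seq t := (⨆ s ≤ t, MeasurableSpace.comap (X s) inferInstance) ⊔
    MeasurableSpace.generateFrom {B | MeasurableSet B ∧ P B = 0}
  mono' _ _ hst := sup_le_sup_right (biSup_mono fun _ h => h.trans hst) _
  le' _ := sup_le (iSup₂_le fun s _ => (hX s).comap_le)
    (MeasurableSpace.generateFrom_le fun _ h => h.1)

/-- The process `M_t = X_t - X_0 - ∫_{]0,t]} A_s X_{s-} ds`. -/
def martingalePart (A : ℝ≥0 → Matrix (Fin N) (Fin N) ℝ) (X : ℝ≥0 → Ω → Fin N → ℝ)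
    (t : ℝ≥0) (ω : Ω) : Fin N → ℝ :=
  X t ω - X 0 ω - ∫ s in Set.Ioc 0 t, A s *ᵥ pre (X · ω) s ∂leb

/-- `X` is a continuous-time Markov chain with rate matrix `A`, deterministic initial state and
states `e i`: a right-continuous pure jump process (càdlàg, with values in a finite set) which
solves the martingale problem for `A`. -/
structure IsMarkovChain (P : Measure Ω) (X : ℝ≥0 → Ω → Fin N → ℝ)
    (A : ℝ≥0 → Matrix (Fin N) (Fin N) ℝ) : Prop where
  measurable : ∀ t, Measurable (X t)
  mem_states : ∀ t ω, ∃ i, X t ω = e i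
  initial : ∃ i, ∀ ω, X 0 ω = e i
  right_cont : ∀ ω t, ContinuousWithinAt (X · ω) (Set.Ici t) t
  left_lim : ∀ ω t, ∃ x, Tendsto (X · ω) (𝓝[<] t) (𝓝 x)
  rate : IsRateMatrix A
  martingale : Martingale (martingalePart A X) (chainFiltration P X measurable) P

/-- `∫_{]0,t]} Z_s^* dM_s`. The martingale part `M` of the chain is a pure jump process plus an
absolutely continuous one, `dM_s = ΔX_s - A_s X_{s-} ds`, with finitely many jumps on `]0,t]`, and
the integral is the pathwise Stieltjes integral. -/
def stochInt (A : ℝ≥0 → Matrix (Fin N) (Fin N) ℝ) (X : ℝ≥0 → Ω → Fin N → ℝ)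
    (Z : ℝ≥0 → Ω → Fin N → ℝ) (t : ℝ≥0) (ω : Ω) : ℝ :=
  (∑ᶠ s ∈ Set.Ioc 0 t, Z s ω ⬝ᵥ (X s ω - pre (X · ω) s)) -
    ∫ s in Set.Ioc 0 t, Z s ω ⬝ᵥ (A s *ᵥ pre (X · ω) s) ∂leb

/-- `Ψ(A, x) = diag(A x) - A diag(x) - diag(x) A^*`, so that `d⟨M,M⟩_t/dt = Ψ(A_t, X_{t-})`. -/
def Psi (A : Matrix (Fin N) (Fin N) ℝ) (x : Fin N → ℝ) : Matrix (Fin N) (Fin N) ℝ :=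
  Matrix.diagonal (A *ᵥ x) - A * Matrix.diagonal x - Matrix.diagonal x * Aᵀ

/-- The squared stochastic seminorm `‖z‖²_{M_t} = Tr(z^* Ψ(A_t, X_{t-}) z)` of a vector `z`. -/
def seminormSq (A : ℝ≥0 → Matrix (Fin N) (Fin N) ℝ) (X : ℝ≥0 → Ω → Fin N → ℝ)
    (t : ℝ≥0) (ω : Ω) (z : Fin N → ℝ) : ℝ :=
  z ⬝ᵥ (Psi (A t) (pre (X · ω) t) *ᵥ z)

/-- The equivalence `Z ∼_M Z'`: `‖Z_t - Z'_t‖_{M_t} = 0` for `dt × dP`-almost every `(t, ω)`. -/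
def EquivM (P : Measure Ω) (X : ℝ≥0 → Ω → Fin N → ℝ) (A : ℝ≥0 → Matrix (Fin N) (Fin N) ℝ)
    (Z Z' : ℝ≥0 → Ω → Fin N → ℝ) : Prop :=
  ∀ᵐ p : ℝ≥0 × Ω ∂(leb.prod P), seminormSq A X p.1 p.2 (Z p.1 p.2 - Z' p.1 p.2) = 0

/-- A driver `f(ω, t, y, z)` is progressively measurable: for each `t` its restriction to times
`s ≤ t` is `Borel([0,t]) ⊗ ℱ_t ⊗ Borel(ℝ) ⊗ Borel(ℝ^N)`-measurable. -/
def ProgDriver (ℱ : Filtration ℝ≥0 mΩ) (f : Ω → ℝ≥0 → ℝ → (Fin N → ℝ) → ℝ) : Prop :=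
  ∀ t : ℝ≥0, Measurable[(Subtype.instMeasurableSpace.prod (ℱ t)).prod inferInstance]
    fun p : (Set.Iic t × Ω) × (ℝ × (Fin N → ℝ)) => f p.1.2 p.1.1 p.2.1 p.2.2

/-- The driver `f` only sees `Z` up to the equivalence `∼_M`. -/
def InvariantDriver (P : Measure Ω) (X : ℝ≥0 → Ω → Fin N → ℝ)
    (A : ℝ≥0 → Matrix (Fin N) (Fin N) ℝ) (ℱ : Filtration ℝ≥0 mΩ)
    (f : Ω → ℝ≥0 → ℝ → (Fin N → ℝ) → ℝ) : Prop :=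
  ∀ Z Z' : ℝ≥0 → Ω → Fin N → ℝ, IsStronglyPredictable ℱ Z → IsStronglyPredictable ℱ Z' →
    EquivM P X A Z Z' →
      ∀ᵐ p : ℝ≥0 × Ω ∂(leb.prod P), ∀ y, f p.2 p.1 y (Z p.1 p.2) = f p.2 p.1 y (Z' p.1 p.2)

/-- `(Y, Z)` has dynamics `dY_t = -f(ω, t, Y_{t-}, Z_t) dt + Z_t^* dM_t` on the time interval
`{t : t ≤ T}`; the horizon `T` may be `∞`. The processes are adapted resp. predictable,
`E[sup_{t < S} Y_t^2] < ∞` for every finite `S ≤ T`, and all integrals exist. -/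
structure IsSolution (P : Measure Ω) (X : ℝ≥0 → Ω → Fin N → ℝ)
    (A : ℝ≥0 → Matrix (Fin N) (Fin N) ℝ) (ℱ : Filtration ℝ≥0 mΩ) (T : ℝ≥0∞)
    (f : Ω → ℝ≥0 → ℝ → (Fin N → ℝ) → ℝ) (Y : ℝ≥0 → Ω → ℝ) (Z : ℝ≥0 → Ω → Fin N → ℝ) :
    Prop where
  adapted : StronglyAdapted ℱ Y
  predictable : IsStronglyPredictable ℱ Z
  sup_sq : ∀ S : ℝ≥0, (S : ℝ≥0∞) ≤ T → ∫⁻ ω, ⨆ (t : ℝ≥0) (_ : t < S), ‖Y t ω‖ₑ ^ 2 ∂P < ∞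
  integrable_driver : ∀ᵐ ω ∂P, ∀ t : ℝ≥0, (t : ℝ≥0∞) ≤ T →
    IntegrableOn (fun s => f ω s (pre (Y · ω) s) (Z s ω)) (Set.Ioc 0 t) leb
  integrable_comp : ∀ᵐ ω ∂P, ∀ t : ℝ≥0, (t : ℝ≥0∞) ≤ T →
    IntegrableOn (fun s => Z s ω ⬝ᵥ (A s *ᵥ pre (X · ω) s)) (Set.Ioc 0 t) leb
  dynamics : ∀ᵐ ω ∂P, ∀ t : ℝ≥0, (t : ℝ≥0∞) ≤ T →
    Y t ω = Y 0 ω - (∫ s in Set.Ioc 0 t, f ω s (pre (Y · ω) s) (Z s ω) ∂leb) + stochInt A X Z t ω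

/-- `Y` is Markovian with function `u`: `Y_t = u(t, X_t)` for all `t ≤ T`, up to
indistinguishability. -/
def IsMarkovianWith (P : Measure Ω) (X : ℝ≥0 → Ω → Fin N → ℝ) (T : ℝ≥0∞) (Y : ℝ≥0 → Ω → ℝ)
    (u : ℝ≥0 → (Fin N → ℝ) → ℝ) : Prop :=
  ∀ᵐ ω ∂P, ∀ t : ℝ≥0, (t : ℝ≥0∞) ≤ T → Y t ω = u t (X t ω)

/-- `f(ω, t, Y_t, Z_t) = f̃(X_t, t, Y_t, Z_t)` for `dt × dP`-almost every `(t, ω)` with `t ≤ T`.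
The process `Z` of a solution is only determined up to `∼_M`, and the identity is understood
for `Z` as an equivalence class, that is, for each predictable representative. -/
def IsMarkovianDriver (P : Measure Ω) (X : ℝ≥0 → Ω → Fin N → ℝ)
    (A : ℝ≥0 → Matrix (Fin N) (Fin N) ℝ) (ℱ : Filtration ℝ≥0 mΩ) (T : ℝ≥0∞)
    (f : Ω → ℝ≥0 → ℝ → (Fin N → ℝ) → ℝ) (Y : ℝ≥0 → Ω → ℝ) (Z : ℝ≥0 → Ω → Fin N → ℝ)
    (f' : (Fin N → ℝ) → ℝ≥0 → ℝ → (Fin N → ℝ) → ℝ) : Prop :=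
  ∀ Z' : ℝ≥0 → Ω → Fin N → ℝ, IsStronglyPredictable ℱ Z' → EquivM P X A Z Z' →
    ∀ᵐ p : ℝ≥0 × Ω ∂(leb.prod P), (p.1 : ℝ≥0∞) ≤ T →
      f p.2 p.1 (Y p.1 p.2) (Z' p.1 p.2) = f' (X p.1 p.2) p.1 (Y p.1 p.2) (Z' p.1 p.2)

end Chain

/-- The vector `𝐮_t` with components `u(t, e i)`. -/
def uVec {N : ℕ} (u : ℝ≥0 → (Fin N → ℝ) → ℝ) (t : ℝ≥0) : Fin N → ℝ := fun i => u t (e i)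

/-- The vector `𝐟(t, v)` with components `f̃(e i, t, e_i^* v, v)`. -/
def fVec {N : ℕ} (f' : (Fin N → ℝ) → ℝ≥0 → ℝ → (Fin N → ℝ) → ℝ) (t : ℝ≥0) (v : Fin N → ℝ) :
    Fin N → ℝ := fun i => f' (e i) t (v i) v

/-- The right-hand side `-(𝐟(t, v) + A_t^* v)` of the coupled system of ODEs. -/
def odeField {N : ℕ} (A : ℝ≥0 → Matrix (Fin N) (Fin N) ℝ)
    (f' : (Fin N → ℝ) → ℝ≥0 → ℝ → (Fin N → ℝ) → ℝ) (t : ℝ≥0) (v : Fin N → ℝ) : Fin N → ℝ :=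
  -(fVec f' t v + (A t)ᵀ *ᵥ v)

end

end MarkovBSDE

/-! ### Step paths: local constancy, finiteness of jumps, telescoping. -/

namespace MarkovBSDE

noncomputable section

/-! While the chain sits in state `e i`, the process `Y` is `u(·, e i)`, so there `u(·, e i)` is a
primitive of `h = -(f + Z^* A X_-)`. At a fixed time `r > 0` the chain almost surely does not jump
and is in `e i` with positive probability, so some good path stays in `e i` near `r`. Hence `u(·, e
i)` is locally the integral of its derivative, and connectedness makes this global
(`IsSolution.incrementEq`). Lebesgue differentiation identifies `h` with the deterministic function
`timeDeriv u i` at almost every time spent in `e i` (`IsPathSolution.ae_eq_timeDeriv`).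

Now `u` is continuous in time, so at a jump from `e j` to `e k` the jump of `u(t, X_t)` forces `Z_k
- Z_j = u(t, e k) - u(t, e j)` (`IsPathSolution.jump_eq`). Jump times are a null set, so this must
be spread over `dt × dP`: the number of such jumps in a predictable set has expectation the integral
of the rate `1{X_- = e_j} A_kj` (`jumpCount_compensator`, derived from the martingale property by
Riemann sums and a π-λ argument). The predictable set where the increments differ sees no jumps, so
the rate vanishes on it almost everywhere. This says `Z ∼_M 𝐮`.

Since columns of `A` sum to zero, `Z^* A e_i` may be replaced by `(A^* 𝐮)_i`, so `f` along the
solution equals `-u_i' - (A^* 𝐮)_i`, a function of time and state (`ae_driver_eq`). For a given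
`f̃`, using `𝐮` as representative of `Z` and positivity of `P(X_t = e_i)` turns the `dt × dP`
identity into the differential equation for almost every `t` (`ae_odeField_eq`). -/

theorem e_injective {N : ℕ} : Injective (e : Fin N → Fin N → ℝ) := fun i j h => by
  by_contra hij
  have := congrFun h i
  simp [e, hij] at this

@[simp] theorem e_inj {N : ℕ} {i j : Fin N} : e i = e j ↔ i = j := e_injective.eq_iff

/-- A right-continuous path with left limits and values in the basis vectors. -/
structure IsStepPath {N : ℕ} (x : ℝ≥0 → Fin N → ℝ) : Prop where
  mem_states : ∀ t, ∃ i, x t = e i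
  right_cont : ∀ t, ContinuousWithinAt x (Set.Ici t) t
  left_lim : ∀ t, ∃ y, Tendsto x (𝓝[<] t) (𝓝 y)

/-- There are finitely many states, so `y` has a neighbourhood free of states other than `y`. -/
theorem eventually_eq_of_tendsto_states {N : ℕ} {α : Type*} {l : Filter α} {x : α → Fin N → ℝ}
    {y : Fin N → ℝ} (hs : ∀ t, ∃ i, x t = e i) (h : Tendsto x l (𝓝 y)) :
    ∀ᶠ s in l, x s = y := by
  have hfin : (Set.range (e : Fin N → Fin N → ℝ) \ {y}).Finite := (Set.finite_range _).sdiff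
  have : (Set.range (e : Fin N → Fin N → ℝ) \ {y})ᶜ ∈ 𝓝 y :=
    hfin.isClosed.isOpen_compl.mem_nhds (by simp)
  filter_upwards [h this] with s hs'
  obtain ⟨i, hi⟩ := hs s
  by_contra hne
  exact hs' ⟨⟨i, hi.symm⟩, hne⟩

namespace IsStepPath

variable {N : ℕ} {x : ℝ≥0 → Fin N → ℝ} (hx : IsStepPath x)
include hx

theorem eventually_right (t : ℝ≥0) : ∀ᶠ s in 𝓝[≥] t, x s = x t :=
  eventually_eq_of_tendsto_states hx.mem_states (hx.right_cont t)

theorem eventually_left (t : ℝ≥0) : ∀ᶠ s in 𝓝[<] t, x s = pre x t :=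
  eventually_eq_of_tendsto_states hx.mem_states (tendsto_leftLim_of_tendsto (hx.left_lim t))

theorem pre_mem_states (t : ℝ≥0) : ∃ i, pre x t = e i := by
  rcases eq_or_neBot (𝓝[<] t) with h | h
  · rw [pre, leftLim_eq_of_eq_bot _ h]; exact hx.mem_states t
  · obtain ⟨s, hs⟩ := (hx.eventually_left t).exists
    rw [← hs]; exact hx.mem_states s

theorem pre_eq_of_eventually {t : ℝ≥0} (ht : 0 < t) {y : Fin N → ℝ}
    (h : ∀ᶠ s in 𝓝[<] t, x s = y) : pre x t = y := by
  have : (𝓝[<] t).NeBot := nhdsLT_neBot_of_exists_lt ⟨0, ht⟩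
  obtain ⟨s, h1, h2⟩ := (h.and (hx.eventually_left t)).exists
  rw [← h1, h2]

theorem exists_right (t : ℝ≥0) : ∃ b, t < b ∧ ∀ s, t ≤ s → s < b → x s = x t := by
  obtain ⟨b, hb, h⟩ := (mem_nhdsGE_iff_exists_Ico_subset' (show t < t + 1 by simp)).1
    (hx.eventually_right t)
  exact ⟨b, hb, fun s h1 h2 => h ⟨h1, h2⟩⟩

theorem exists_left {t : ℝ≥0} (ht : 0 < t) :
    ∃ a, a < t ∧ ∀ s, a ≤ s → s < t → x s = pre x t := by
  obtain ⟨a, ha, h⟩ := (mem_nhdsLT_iff_exists_Ioo_subset' ht).1 (hx.eventually_left t)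
  obtain ⟨c, hc, hct⟩ := exists_between (Set.mem_Iio.1 ha)
  exact ⟨c, hct, fun s h1 h2 => h ⟨hc.trans_le h1, h2⟩⟩

theorem pre_eq_of_const {a b : ℝ≥0} {y : Fin N → ℝ} (h : ∀ s, a ≤ s → s < b → x s = y)
    {s : ℝ≥0} (h1 : a < s) (h2 : s ≤ b) : pre x s = y := by
  refine hx.pre_eq_of_eventually (bot_lt_of_lt h1) ?_
  filter_upwards [Ico_mem_nhdsLT h1] with r hr
  exact h r hr.1 (hr.2.trans_le h2)

omit hx in
theorem pre_zero : pre x 0 = x 0 := leftLim_eq_of_isBot fun _ => zero_le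

theorem eventually_pre_eq (t : ℝ≥0) : ∀ᶠ s in 𝓝[≠] t, pre x s = x s := by
  rw [← nhdsLT_sup_nhdsGT, eventually_sup]
  constructor
  · rcases eq_zero_or_pos t with rfl | ht
    · simp
    · obtain ⟨a, ha, h⟩ := hx.exists_left ht
      filter_upwards [Ioo_mem_nhdsLT ha] with s hs
      rw [h s hs.1.le hs.2, hx.pre_eq_of_const h hs.1 hs.2.le]
  · obtain ⟨b, hb, h⟩ := hx.exists_right t
    filter_upwards [Ioo_mem_nhdsGT hb] with s hs
    rw [h s hs.1.le hs.2, hx.pre_eq_of_const h hs.1 hs.2.le]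

/-- Each time has a neighbourhood in which it is the only possible jump; `[0, b]` is compact. -/
theorem finite_jumps (b : ℝ≥0) : (Set.Ioc 0 b ∩ {s | pre x s ≠ x s}).Finite := by
  have h1 : ∀ t ∈ Set.Icc 0 b, {s | s ≠ t → pre x s = x s} ∈ 𝓝 t := fun t _ =>
    eventually_nhdsWithin_iff.1 (hx.eventually_pre_eq t)
  obtain ⟨F, -, hF⟩ := (isCompact_Icc (a := (0 : ℝ≥0)) (b := b)).elim_nhds_subcover
    (fun t => {s | s ≠ t → pre x s = x s}) h1
  refine F.finite_toSet.subset fun s hs => ?_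
  obtain ⟨t, ht, hst⟩ := Set.mem_iUnion₂.1 (hF ⟨hs.1.1.le, hs.1.2⟩)
  by_contra hne
  exact hs.2 (hst fun h => hne (h ▸ ht))

end IsStepPath

/-- The jump times of the path `x` on `]0, b]`. -/
def jumpTimes {N : ℕ} (x : ℝ≥0 → Fin N → ℝ) (b : ℝ≥0) : Finset ℝ≥0 := by
  classical
  -- The default `∅` is never reached for step paths, by `finite_jumps`.
  exact if h : (Set.Ioc 0 b ∩ {s | pre x s ≠ x s}).Finite then h.toFinset else ∅

namespace IsStepPath

variable {N : ℕ} {x : ℝ≥0 → Fin N → ℝ} (hx : IsStepPath x)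
include hx

theorem mem_jumpTimes {b s : ℝ≥0} : s ∈ jumpTimes x b ↔ (0 < s ∧ s ≤ b) ∧ pre x s ≠ x s := by
  simp [jumpTimes, hx.finite_jumps b]

theorem countable_jumps : {s | pre x s ≠ x s}.Countable := by
  refine (Set.countable_iUnion fun n : ℕ => (hx.finite_jumps n).countable).mono fun s hs => ?_
  obtain ⟨n, hn⟩ := exists_nat_ge s
  refine Set.mem_iUnion.2 ⟨n, ⟨pos_iff_ne_zero.2 ?_, hn⟩, hs⟩
  rintro rfl
  exact hs pre_zero

/-- The difference of the jump sum and `x b` is locally constant in `b`, hence constant on the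
connected half-line; at `b = 0` it is `-x 0`. -/
theorem sum_jumpTimes_eq (b : ℝ≥0) : ∑ s ∈ jumpTimes x b, (x s - pre x s) = x b - x 0 := by
  classical
  have key : ∀ c ∈ Set.univ, ∀ᶠ y in 𝓝[Set.univ] c,
      (∑ s ∈ jumpTimes x c, (x s - pre x s) - x c = ∑ s ∈ jumpTimes x y, (x s - pre x s) - x y) ∧
      (∑ s ∈ jumpTimes x y, (x s - pre x s) - x y
        = ∑ s ∈ jumpTimes x c, (x s - pre x s) - x c) := by
    intro c _
    rw [nhdsWithin_univ]
    have hr := eventually_nhdsWithin_iff.1 (hx.eventually_right c)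
    have hl := eventually_nhdsWithin_iff.1 (hx.eventually_left c)
    suffices h : ∀ᶠ y in 𝓝 c, (∑ s ∈ jumpTimes x y, (x s - pre x s) - x y
        = ∑ s ∈ jumpTimes x c, (x s - pre x s) - x c) by
      filter_upwards [h] with y hy
      exact ⟨hy.symm, hy⟩
    rw [← nhdsLT_sup_nhdsGE, eventually_sup]
    constructor
    · rcases eq_zero_or_pos c with rfl | hc
      · simp
      · obtain ⟨a, ha, h⟩ := hx.exists_left hc
        filter_upwards [Ico_mem_nhdsLT ha] with y hy
        have hsub : jumpTimes x y ⊆ jumpTimes x c := fun s hs => by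
          rw [hx.mem_jumpTimes] at hs ⊢
          exact ⟨⟨hs.1.1, hs.1.2.trans hy.2.le⟩, hs.2⟩
        -- On `]y, c]` the only possible jump is at `c` itself.
        have : ∑ s ∈ jumpTimes x c \ jumpTimes x y, (x s - pre x s) = x c - pre x c := by
          by_cases hj : pre x c = x c
          · rw [hj, sub_self]
            refine Finset.sum_eq_zero fun s hs => ?_
            rw [Finset.mem_sdiff, hx.mem_jumpTimes, hx.mem_jumpTimes] at hs
            obtain ⟨⟨⟨h1, h2⟩, h3⟩, h4⟩ := hs
            have h5 : y < s := by
              by_contra h5; exact h4 ⟨⟨h1, not_lt.1 h5⟩, h3⟩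
            rcases h2.lt_or_eq with h6 | rfl
            · rw [h s (hy.1.trans h5.le) h6, hx.pre_eq_of_const h (hy.1.trans_lt h5) h6.le, sub_self]
            · rw [hj, sub_self]
          · have : jumpTimes x c \ jumpTimes x y = {c} := by
              ext s
              rw [Finset.mem_sdiff, hx.mem_jumpTimes, hx.mem_jumpTimes, Finset.mem_singleton]
              constructor
              · rintro ⟨⟨⟨h1, h2⟩, h3⟩, h4⟩
                have h5 : y < s := by
                  by_contra h5; exact h4 ⟨⟨h1, not_lt.1 h5⟩, h3⟩
                by_contra h6
                have h6 := lt_of_le_of_ne h2 h6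
                exact h3 (by rw [h s (hy.1.trans h5.le) h6,
                  hx.pre_eq_of_const h (hy.1.trans_lt h5) h6.le])
              · rintro rfl
                exact ⟨⟨⟨hc, le_rfl⟩, hj⟩, fun h => absurd h.1.2 (not_le.2 hy.2)⟩
            rw [this, Finset.sum_singleton]
        rw [← Finset.sum_sdiff hsub, this, h y hy.1 hy.2]
        abel
    · obtain ⟨b, hb, h⟩ := hx.exists_right c
      filter_upwards [Ico_mem_nhdsGE hb] with y hy
      have : jumpTimes x y = jumpTimes x c := by
        ext s
        rw [hx.mem_jumpTimes, hx.mem_jumpTimes]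
        refine ⟨fun hs => ⟨⟨hs.1.1, ?_⟩, hs.2⟩, fun hs => ⟨⟨hs.1.1, hs.1.2.trans hy.1⟩, hs.2⟩⟩
        by_contra hcs
        have hcs := not_le.1 hcs
        exact hs.2 (by rw [h s hcs.le (hs.1.2.trans_lt hy.2),
          hx.pre_eq_of_const h hcs (hs.1.2.trans hy.2.le)])
      rw [this, h y hy.1 hy.2]
  have := isPreconnected_univ.induction₂' (fun y z => ∑ s ∈ jumpTimes x y, (x s - pre x s) - x y
    = ∑ s ∈ jumpTimes x z, (x s - pre x s) - x z) key
    (fun _ _ _ _ _ _ => Eq.trans) (Set.mem_univ b) (Set.mem_univ 0)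
  have h0 : jumpTimes x 0 = ∅ := by
    ext s
    rw [hx.mem_jumpTimes]
    simp only [Finset.notMem_empty, iff_false]
    rintro ⟨⟨h1, h2⟩, -⟩
    exact absurd h2 (not_le.2 h1)
  simp only [h0, Finset.sum_empty, zero_sub] at this
  rw [sub_eq_iff_eq_add] at this
  rw [this]; abel

theorem jumpTimes_filter_le {a b : ℝ≥0} (hab : a ≤ b) :
    (jumpTimes x b).filter (fun s => ¬ a < s) = jumpTimes x a := by
  ext s
  rw [Finset.mem_filter, hx.mem_jumpTimes, hx.mem_jumpTimes]
  refine ⟨fun h => ⟨⟨h.1.1.1, not_lt.1 h.2⟩, h.1.2⟩, fun h => ⟨⟨⟨h.1.1, h.1.2.trans hab⟩, h.2⟩,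
    not_lt.2 h.1.2⟩⟩

theorem sum_jumpTimes_filter {a b c : ℝ≥0} (hab : a ≤ b) (hbc : b ≤ c) :
    ∑ s ∈ (jumpTimes x c).filter (· ∈ Set.Ioc a b), (x s - pre x s) = x b - x a := by
  have h1 := hx.sum_jumpTimes_eq b
  rw [← Finset.sum_filter_add_sum_filter_not _ (fun s => a < s), hx.jumpTimes_filter_le hab,
    hx.sum_jumpTimes_eq a] at h1
  have h2 : (jumpTimes x c).filter (· ∈ Set.Ioc a b) = (jumpTimes x b).filter (a < ·) := by
    ext s
    rw [Finset.mem_filter, Finset.mem_filter, hx.mem_jumpTimes, hx.mem_jumpTimes]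
    exact ⟨fun h => ⟨⟨⟨h.1.1.1, h.2.2⟩, h.1.2⟩, h.2.1⟩,
      fun h => ⟨⟨⟨h.1.1.1, h.1.1.2.trans hbc⟩, h.1.2⟩, h.2, h.1.1.2⟩⟩
  rw [h2, eq_sub_of_add_eq h1]
  abel

end IsStepPath

/-! ### Uniform partitions and predictable step approximations. -/

/-- The `m`-th point of the partition of `[a, b]` into `n + 1` intervals of equal length. -/
def gridPoint (a b : ℝ≥0) (n m : ℕ) : ℝ≥0 := a + m * ((b - a) / (n + 1))

theorem gridPoint_mono (a b : ℝ≥0) (n : ℕ) : Monotone (gridPoint a b n) := fun m k h => by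
  unfold gridPoint
  gcongr

theorem gridPoint_zero (a b : ℝ≥0) (n : ℕ) : gridPoint a b n 0 = a := by simp [gridPoint]

theorem gridPoint_last {a b : ℝ≥0} (h : a ≤ b) (n : ℕ) : gridPoint a b n (n + 1) = b := by
  unfold gridPoint
  push_cast
  rw [mul_div_cancel₀ _ (by positivity), add_tsub_cancel_of_le h]

theorem gridPoint_succ (a b : ℝ≥0) (n m : ℕ) :
    gridPoint a b n (m + 1) = gridPoint a b n m + (b - a) / (n + 1) := by
  unfold gridPoint
  push_cast
  ring

/-- The left-continuous step function with value `φ t_m` on `]t_m, t_{m+1}]`, for the points `t_m`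
of the `n`-th partition of `[a, b]`. -/
def stepApprox (a b : ℝ≥0) (n : ℕ) (φ : ℝ≥0 → ℝ) (s : ℝ≥0) : ℝ :=
  ∑ m ∈ Finset.range (n + 1),
    (Set.Ioc (gridPoint a b n m) (gridPoint a b n (m + 1))).indicator
      (fun _ => φ (gridPoint a b n m)) s

theorem exists_gridPoint {a b s : ℝ≥0} (n : ℕ) (hs : s ∈ Set.Ioc a b) :
    ∃ m < n + 1, s ∈ Set.Ioc (gridPoint a b n m) (gridPoint a b n (m + 1)) := by
  have := (gridPoint_mono a b n).biUnion_Ico_Ioc_map_succ 0 (n + 1)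
  rw [gridPoint_zero, gridPoint_last (hs.1.le.trans hs.2)] at this
  rw [← this] at hs
  obtain ⟨m, hm, h⟩ := Set.mem_iUnion₂.1 hs
  exact ⟨m, hm.2, h⟩

theorem stepApprox_eq {a b s : ℝ≥0} {n m : ℕ} (φ : ℝ≥0 → ℝ) (hm : m < n + 1)
    (hs : s ∈ Set.Ioc (gridPoint a b n m) (gridPoint a b n (m + 1))) :
    stepApprox a b n φ s = φ (gridPoint a b n m) := by
  rw [stepApprox, Finset.sum_eq_single_of_mem m (Finset.mem_range.2 hm), Set.indicator_of_mem hs]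
  intro k _ hk
  refine Set.indicator_of_notMem (fun h => ?_) _
  exact Set.disjoint_left.1 ((gridPoint_mono a b n).pairwise_disjoint_on_Ioc_succ hk) h hs

/-- The value at `s` is sampled strictly before `s` and within one mesh width, so in the limit only
the behaviour of `φ` just to the left of `s` matters. -/
theorem eventually_stepApprox_eq {a b s : ℝ≥0} {φ : ℝ≥0 → ℝ} {c : ℝ} (hs : s ∈ Set.Ioc a b)
    (h : ∀ᶠ r in 𝓝[<] s, φ r = c) : ∀ᶠ n in atTop, stepApprox a b n φ s = c := by
  obtain ⟨l₀, hl₀, hl'⟩ := (mem_nhdsLT_iff_exists_Ioo_subset' (bot_lt_of_lt hs.1)).1 h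
  obtain ⟨l, hll, hl⟩ := exists_between (Set.mem_Iio.1 hl₀)
  have hlim : Tendsto (fun n : ℕ => (b - a) / ((n : ℝ≥0) + 1)) atTop (𝓝 0) := by
    have := (tendsto_const_div_atTop_nhds_zero_nat ((b - a : ℝ≥0) : ℝ)).comp (tendsto_add_atTop_nat 1)
    rw [← NNReal.tendsto_coe]
    refine this.congr fun n => ?_
    simp
  have hpos : 0 < s - l := tsub_pos_of_lt hl
  filter_upwards [hlim.eventually_lt_const hpos] with n hn
  obtain ⟨m, hm, hsm⟩ := exists_gridPoint n hs
  rw [stepApprox_eq φ hm hsm]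
  refine hl' ⟨hll.trans_le ?_, hsm.1⟩
  have h1 := hsm.2
  rw [gridPoint_succ] at h1
  by_contra h2
  have h2 := not_le.1 h2
  have : s < l + (s - l) := h1.trans_lt (add_lt_add h2 hn)
  rw [add_tsub_cancel_of_le (le_of_lt hl)] at this
  exact lt_irrefl _ this

theorem abs_stepApprox_le {a b s : ℝ≥0} {φ : ℝ≥0 → ℝ} {C : ℝ} (n : ℕ) (hs : s ∈ Set.Ioc a b)
    (h : ∀ r, |φ r| ≤ C) : |stepApprox a b n φ s| ≤ C := by
  obtain ⟨m, hm, hsm⟩ := exists_gridPoint n hs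
  rw [stepApprox_eq φ hm hsm]
  exact h _

/-- The increment over a grid cell is the sum of the jumps in it; interchanging the two sums leaves
a sum over a jump set independent of `n`, where only the weights depend on the grid. -/
theorem IsStepPath.sum_grid_eq {N : ℕ} {x : ℝ≥0 → Fin N → ℝ} (hx : IsStepPath x) {a b : ℝ≥0}
    (hab : a ≤ b) (n : ℕ) (φ : ℝ≥0 → ℝ) (k : Fin N) :
    ∑ m ∈ Finset.range (n + 1), φ (gridPoint a b n m) *
        (x (gridPoint a b n (m + 1)) k - x (gridPoint a b n m) k) =
      ∑ s ∈ (jumpTimes x b).filter (a < ·), stepApprox a b n φ s * (x s k - pre x s k) := by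
  have h1 : ∀ m ∈ Finset.range (n + 1), φ (gridPoint a b n m) *
      (x (gridPoint a b n (m + 1)) k - x (gridPoint a b n m) k) =
      ∑ s ∈ jumpTimes x b, (Set.Ioc (gridPoint a b n m) (gridPoint a b n (m + 1))).indicator
        (fun _ => φ (gridPoint a b n m)) s * (x s k - pre x s k) := by
    intro m hm
    have hb : gridPoint a b n (m + 1) ≤ b := by
      conv_rhs => rw [← gridPoint_last hab n]
      exact gridPoint_mono a b n (by simpa using hm)
    have := congrFun (hx.sum_jumpTimes_filter (gridPoint_mono a b n m.le_succ) hb) k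
    simp only [Finset.sum_apply, Pi.sub_apply] at this
    rw [← this, Finset.mul_sum, Finset.sum_filter]
    refine Finset.sum_congr rfl fun s _ => ?_
    rw [Set.indicator_apply]
    split_ifs <;> simp
  rw [Finset.sum_congr rfl h1, Finset.sum_comm, Finset.sum_filter]
  refine Finset.sum_congr rfl fun s _ => ?_
  rw [← Finset.sum_mul]
  split_ifs with h
  · rfl
  · rw [Finset.sum_eq_zero, zero_mul]
    intro m _
    refine Set.indicator_of_notMem (fun h' => h ?_) _
    refine lt_of_le_of_lt ?_ h'.1
    simp [gridPoint]

end

end MarkovBSDE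

/-! ### Lebesgue measure on the half-line, and joint measurability of paths and left limits. -/

namespace MarkovBSDE

noncomputable section

theorem measurableEmbedding_coe_nnreal : MeasurableEmbedding ((↑) : ℝ≥0 → ℝ) :=
  MeasurableEmbedding.subtype_coe measurableSet_Ici

theorem map_coe_leb : leb.map ((↑) : ℝ≥0 → ℝ) = volume.restrict (Set.Ici 0) := by
  rw [leb, measurableEmbedding_coe_nnreal.map_comap]
  congr 1
  exact Subtype.range_coe

theorem coe_preimage_Ioc (a b : ℝ≥0) : ((↑) : ℝ≥0 → ℝ) ⁻¹' Set.Ioc (a : ℝ) b = Set.Ioc a b := by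
  ext; simp

theorem restrict_restrict_Ioc (a b : ℝ≥0) :
    (volume.restrict (Set.Ici (0 : ℝ))).restrict (Set.Ioc (a : ℝ) b) =
      volume.restrict (Set.Ioc (a : ℝ) b) := by
  rw [Measure.restrict_restrict measurableSet_Ioc, Set.inter_eq_left.2]
  exact fun x hx => a.2.trans hx.1.le

theorem leb_Ioc (a b : ℝ≥0) : leb (Set.Ioc a b) = ENNReal.ofReal (b - a) := by
  rw [← coe_preimage_Ioc, ← measurableEmbedding_coe_nnreal.map_apply, map_coe_leb,
    ← Measure.restrict_apply_self, restrict_restrict_Ioc, Measure.restrict_apply_self,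
    Real.volume_Ioc]

instance : SigmaFinite leb := by
  refine ⟨⟨⟨fun n => Set.Icc 0 (n : ℝ≥0), fun _ => trivial, fun n => ?_, ?_⟩⟩⟩
  · rw [leb, measurableEmbedding_coe_nnreal.comap_apply]
    refine (measure_mono (t := Set.Icc (0 : ℝ) n) ?_).trans_lt (by simp)
    rintro _ ⟨x, hx, rfl⟩
    exact ⟨x.2, by exact_mod_cast hx.2⟩
  · exact Set.eq_univ_of_forall fun x =>
      Set.mem_iUnion.2 ((exists_nat_ge x).imp fun n hn => ⟨zero_le, hn⟩)

instance : NullSingletonClass leb := ⟨fun x => by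
  rw [leb, measurableEmbedding_coe_nnreal.comap_apply]; simp⟩

theorem integrableOn_leb_iff {a b : ℝ≥0} (hab : a ≤ b) {h : ℝ≥0 → ℝ} :
    IntegrableOn h (Set.Ioc a b) leb ↔
      IntervalIntegrable (fun r => h r.toNNReal) volume a b := by
  rw [intervalIntegrable_iff_integrableOn_Ioc_of_le (NNReal.coe_le_coe.2 hab), IntegrableOn,
    IntegrableOn, ← restrict_restrict_Ioc, ← map_coe_leb,
    measurableEmbedding_coe_nnreal.restrict_map, measurableEmbedding_coe_nnreal.integrable_map_iff,
    coe_preimage_Ioc]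
  simp [Function.comp_def]

theorem setIntegral_leb {a b : ℝ≥0} (hab : a ≤ b) (h : ℝ≥0 → ℝ) :
    ∫ s in Set.Ioc a b, h s ∂leb = ∫ r in (a : ℝ)..b, h r.toNNReal := by
  rw [intervalIntegral.integral_of_le (NNReal.coe_le_coe.2 hab), ← restrict_restrict_Ioc,
    ← map_coe_leb, measurableEmbedding_coe_nnreal.setIntegral_map, coe_preimage_Ioc]
  simp

theorem ae_leb_of_ae {p : ℝ → Prop} (h : ∀ᵐ r : ℝ, p r) : ∀ᵐ t : ℝ≥0 ∂leb, p t :=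
  measurableEmbedding_coe_nnreal.ae_map_iff.1 (map_coe_leb ▸ ae_restrict_of_ae h)

theorem integrableOn_leb_of_bounded {a b : ℝ≥0} {h : ℝ≥0 → ℝ} {C : ℝ} (hm : Measurable h)
    (hb : ∀ s, |h s| ≤ C) : IntegrableOn h (Set.Ioc a b) leb :=
  Measure.integrableOn_of_bounded (M := C) (by simp [leb_Ioc]) hm.aestronglyMeasurable
    (Eventually.of_forall hb)

theorem abs_setIntegral_leb_le {C : ℝ} {h : ℝ≥0 → ℝ} {a b : ℝ≥0} (hab : a ≤ b)
    (hC : ∀ s ∈ Set.Ioc a b, |h s| ≤ C) :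
    |∫ s in Set.Ioc a b, h s ∂leb| ≤ C * (b - a) := by
  have := norm_setIntegral_le_of_norm_le_const (μ := leb) (s := Set.Ioc a b) (f := h) (C := C)
    (by simp [leb_Ioc]) hC
  rwa [Real.norm_eq_abs, measureReal_def, leb_Ioc,
    ENNReal.toReal_ofReal (sub_nonneg.2 (NNReal.coe_le_coe.2 hab))] at this

theorem IsStepPath.ae_pre_eq {N : ℕ} {x : ℝ≥0 → Fin N → ℝ} (hx : IsStepPath x) :
    ∀ᵐ s ∂leb, pre x s = x s := by
  rw [ae_iff]
  exact hx.countable_jumps.measure_zero _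

section Measurability

variable {N : ℕ} {Ω : Type*} [mΩ : MeasurableSpace Ω] {X : ℝ≥0 → Ω → Fin N → ℝ}

theorem measurable_sample (hX : ∀ t, Measurable (X t)) (τ : ℕ → ℝ≥0) {g : ℝ≥0 → ℕ}
    (hg : Measurable g) : Measurable fun p : ℝ≥0 × Ω => X (τ (g p.1)) p.2 := by
  have : Measurable fun q : ℕ × Ω => X (τ q.1) q.2 :=
    measurable_from_prod_countable_right fun n => hX (τ n)
  exact this.comp ((hg.comp measurable_fst).prodMk measurable_snd)

/-- Sampling at the next grid point strictly after `t` is eventually exact, by right-continuity. -/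
theorem measurable_uncurry_of_isStepPath (hX : ∀ t, Measurable (X t))
    (hs : ∀ ω, IsStepPath (X · ω)) : Measurable fun p : ℝ≥0 × Ω => X p.1 p.2 := by
  refine measurable_of_tendsto_metrizable (f := fun (n : ℕ) (p : ℝ≥0 × Ω) =>
    X (((⌊((n : ℝ≥0) + 1) * p.1⌋₊ + 1 : ℕ) : ℝ≥0) / ((n : ℝ≥0) + 1)) p.2) (fun n => ?_) ?_
  · exact measurable_sample hX (fun m => ((m + 1 : ℕ) : ℝ≥0) / ((n : ℝ≥0) + 1))
      (g := fun t => ⌊((n : ℝ≥0) + 1) * t⌋₊) (Nat.measurable_floor.comp (measurable_const_mul _))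
  · rw [tendsto_pi_nhds]
    rintro ⟨t, ω⟩
    obtain ⟨b, hb, h⟩ := (hs ω).exists_right t
    have hlim : ∀ᶠ n : ℕ in atTop, 1 / ((n : ℝ≥0) + 1) < b - t :=
      tendsto_one_div_add_atTop_nhds_zero_nat.eventually_lt_const (tsub_pos_of_lt hb)
    refine tendsto_nhds_of_eventually_eq ?_
    filter_upwards [hlim] with n hn
    have hpos : (0 : ℝ≥0) < (n : ℝ≥0) + 1 := by positivity
    refine h _ ?_ ?_
    · rw [le_div_iff₀ hpos, mul_comm]
      exact_mod_cast (Nat.lt_floor_add_one _).le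
    · have h1 : ((⌊((n : ℝ≥0) + 1) * t⌋₊ + 1 : ℕ) : ℝ≥0) / ((n : ℝ≥0) + 1)
          ≤ t + 1 / ((n : ℝ≥0) + 1) := by
        rw [div_le_iff₀ hpos, add_mul t, div_mul_cancel₀ _ hpos.ne']
        push_cast
        gcongr
        rw [mul_comm t]
        exact Nat.floor_le zero_le
      refine h1.trans_lt ?_
      calc t + 1 / ((n : ℝ≥0) + 1) < t + (b - t) := by gcongr
        _ = b := add_tsub_cancel_of_le hb.le

/-- For `t > 0` the sample point `(⌈(n+1)t⌉ - 1)/(n+1)` is strictly before `t`, so it eventually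
sees the left limit. -/
theorem measurable_uncurry_pre (hX : ∀ t, Measurable (X t))
    (hs : ∀ ω, IsStepPath (X · ω)) : Measurable fun p : ℝ≥0 × Ω => pre (X · p.2) p.1 := by
  refine measurable_of_tendsto_metrizable (f := fun (n : ℕ) (p : ℝ≥0 × Ω) =>
    X (((⌈((n : ℝ≥0) + 1) * p.1⌉₊ - 1 : ℕ) : ℝ≥0) / ((n : ℝ≥0) + 1)) p.2) (fun n => ?_) ?_
  · exact measurable_sample hX (fun m => ((m - 1 : ℕ) : ℝ≥0) / ((n : ℝ≥0) + 1))
      (g := fun t => ⌈((n : ℝ≥0) + 1) * t⌉₊) (Nat.measurable_ceil.comp (measurable_const_mul _))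
  · rw [tendsto_pi_nhds]
    rintro ⟨t, ω⟩
    refine tendsto_nhds_of_eventually_eq ?_
    rcases eq_zero_or_pos t with rfl | ht
    -- Truncated subtraction samples at time `0`, in agreement with `x_{0-} = x_0`.
    · simp [IsStepPath.pre_zero]
    obtain ⟨a, ha, h⟩ := (hs ω).exists_left ht
    have hlim : ∀ᶠ n : ℕ in atTop, 1 / ((n : ℝ≥0) + 1) < t - a :=
      tendsto_one_div_add_atTop_nhds_zero_nat.eventually_lt_const (tsub_pos_of_lt ha)
    filter_upwards [hlim] with n hn
    have hpos : (0 : ℝ≥0) < (n : ℝ≥0) + 1 := by positivity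
    have hc : 0 < ⌈((n : ℝ≥0) + 1) * t⌉₊ := Nat.ceil_pos.2 (by positivity)
    refine h _ ?_ ?_
    · rw [le_div_iff₀ hpos]
      have h1 : a + 1 / ((n : ℝ≥0) + 1) ≤ t := by
        calc a + 1 / ((n : ℝ≥0) + 1) ≤ a + (t - a) := by gcongr
          _ = t := add_tsub_cancel_of_le ha.le
      have h2 : ((n : ℝ≥0) + 1) * t ≤ ((⌈((n : ℝ≥0) + 1) * t⌉₊ - 1 : ℕ) : ℝ≥0) + 1 := by
        refine (Nat.le_ceil _).trans ?_
        exact_mod_cast (Nat.sub_add_cancel hc).ge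
      have h3 : (a + 1 / ((n : ℝ≥0) + 1)) * ((n : ℝ≥0) + 1) = a * ((n : ℝ≥0) + 1) + 1 := by
        rw [add_mul, div_mul_cancel₀ _ hpos.ne']
      have : a * ((n : ℝ≥0) + 1) + 1 ≤ ((⌈((n : ℝ≥0) + 1) * t⌉₊ - 1 : ℕ) : ℝ≥0) + 1 := by
        rw [← h3]
        refine le_trans ?_ h2
        rw [mul_comm _ t]
        gcongr
      exact le_of_add_le_add_right this
    · rw [div_lt_iff₀ hpos, mul_comm t]
      exact Nat.lt_ceil.1 (Nat.sub_lt hc one_pos)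

end Measurability

end

end MarkovBSDE

/-! ### Jump counts as limits of Riemann sums, and the martingale property on a grid. -/

namespace MarkovBSDE

noncomputable section

theorem mulVec_e {N : ℕ} (B : Matrix (Fin N) (Fin N) ℝ) (j k : Fin N) : (B *ᵥ e j) k = B k j := by
  simp [e]

variable {N : ℕ} {Ω : Type*} [mΩ : MeasurableSpace Ω] {P : Measure Ω} [IsProbabilityMeasure P]
  {X : ℝ≥0 → Ω → Fin N → ℝ} {A : ℝ≥0 → Matrix (Fin N) (Fin N) ℝ}

/-- The number of jumps of the path from `e j` to `e k` on `]a, b]`. -/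
def jumpSum (x : ℝ≥0 → Fin N → ℝ) (a b : ℝ≥0) (j k : Fin N) : ℝ :=
  ∑ s ∈ (jumpTimes x b).filter (a < ·),
    Set.indicator {s | pre x s = e j ∧ x s = e k} (fun _ => (1 : ℝ)) s

/-- The Riemann sums `∑ 1{x_{t_m} = e_j} e_k^* (x_{t_{m+1}} - x_{t_m})`. -/
def transitionSum (x : ℝ≥0 → Fin N → ℝ) (a b : ℝ≥0) (j k : Fin N) (n : ℕ) : ℝ :=
  ∑ m ∈ Finset.range (n + 1), Set.indicator {r | x r = e j} (fun _ => (1 : ℝ)) (gridPoint a b n m) *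
    (x (gridPoint a b n (m + 1)) k - x (gridPoint a b n m) k)

namespace IsStepPath

variable {x : ℝ≥0 → Fin N → ℝ} (hx : IsStepPath x)
include hx

/-- At each jump time `s` the weight becomes `1{x_{s-} = e_j}`. On that event the `k`-th component
of the jump is `1{x_s = e_k}`, because `k ≠ j`. -/
theorem tendsto_transitionSum {a b : ℝ≥0} (hab : a ≤ b) {j k : Fin N} (hjk : j ≠ k) :
    Tendsto (transitionSum x a b j k) atTop (𝓝 (jumpSum x a b j k)) := by
  have h1 : transitionSum x a b j k = fun n => _ := funext fun n => hx.sum_grid_eq hab n _ k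
  rw [h1, jumpSum]
  refine tendsto_finsetSum _ fun s hs => ?_
  rw [Finset.mem_filter, hx.mem_jumpTimes] at hs
  have hφ : ∀ᶠ r in 𝓝[<] s, Set.indicator {r | x r = e j} (fun _ => (1 : ℝ)) r =
      if pre x s = e j then 1 else 0 := by
    filter_upwards [hx.eventually_left s] with r hr
    simp [Set.indicator_apply, hr]
  refine tendsto_nhds_of_eventually_eq ?_
  filter_upwards [eventually_stepApprox_eq ⟨hs.2, hs.1.1.2⟩ hφ] with n hn
  rw [hn]
  obtain ⟨i, hi⟩ := hx.mem_states s
  by_cases hp : pre x s = e j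
  · have hik : (e i : Fin N → ℝ) k = if i = k then 1 else 0 := by
      simp [e, Pi.single_apply, eq_comm]
    have hjk' : (e j : Fin N → ℝ) k = 0 := by simp [e, hjk.symm]
    simp [Set.indicator_apply, hp, hi, hik, hjk']
  · simp [hp]

theorem abs_sub_pre_le (s : ℝ≥0) (k : Fin N) : |x s k - pre x s k| ≤ 1 := by
  obtain ⟨i, hi⟩ := hx.mem_states s
  obtain ⟨j, hj⟩ := hx.pre_mem_states s
  rw [hi, hj]
  simp only [e, Pi.single_apply]
  split_ifs <;> simp

theorem abs_transitionSum_le {a b : ℝ≥0} (hab : a ≤ b) (j k : Fin N) (n : ℕ) :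
    |transitionSum x a b j k n| ≤ (jumpTimes x b).card := by
  rw [transitionSum, hx.sum_grid_eq hab n _ k]
  refine (Finset.abs_sum_le_sum_abs _ _).trans ?_
  refine (Finset.sum_le_card_nsmul _ _ 1 fun s hs => ?_).trans ?_
  · rw [Finset.mem_filter, hx.mem_jumpTimes] at hs
    rw [abs_mul]
    refine mul_le_one₀ (abs_stepApprox_le n ⟨hs.2, hs.1.1.2⟩ fun r => ?_) (abs_nonneg _)
      (hx.abs_sub_pre_le s k)
    rw [Set.indicator_apply]
    split_ifs <;> simp
  · rw [nsmul_eq_mul, mul_one]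
    exact_mod_cast Finset.card_filter_le _ _

/-- Starting from `e j`, the `k`-th component can only increase. The sign makes Fatou's lemma
available before any integrable bound is known. -/
theorem transitionSum_nonneg {a b : ℝ≥0} {j k : Fin N} (hjk : j ≠ k) (n : ℕ) :
    0 ≤ transitionSum x a b j k n := by
  refine Finset.sum_nonneg fun m _ => ?_
  rw [Set.indicator_apply]
  split_ifs with h
  · rw [h.out]
    obtain ⟨i, hi⟩ := hx.mem_states (gridPoint a b n (m + 1))
    rw [hi]
    simp only [e, Pi.single_apply, hjk.symm, if_false]
    split_ifs <;> simp
  · simp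

/-- Every jump has exactly one pair of source and target. The total count is the dominating function
for the Riemann sums (`abs_transitionSum_le`). -/
theorem card_jumpTimes (b : ℝ≥0) : ((jumpTimes x b).card : ℝ) =
    ∑ j : Fin N, ∑ k ∈ Finset.univ.erase j, jumpSum x 0 b j k := by
  simp only [jumpSum]
  have h0 : (jumpTimes x b).filter (0 < ·) = jumpTimes x b :=
    Finset.filter_true_of_mem fun s hs => (hx.mem_jumpTimes.1 hs).1.1
  have h1 : ∀ j : Fin N, ∑ k ∈ Finset.univ.erase j, ∑ s ∈ jumpTimes x b,
      Set.indicator {s | pre x s = e j ∧ x s = e k} (fun _ => (1 : ℝ)) s =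
      ∑ s ∈ jumpTimes x b, ∑ k ∈ Finset.univ.erase j,
      Set.indicator {s | pre x s = e j ∧ x s = e k} (fun _ => (1 : ℝ)) s :=
    fun j => Finset.sum_comm
  rw [h0, Finset.sum_congr rfl fun j _ => h1 j, Finset.sum_comm, Finset.card_eq_sum_ones,
    Nat.cast_sum]
  refine Finset.sum_congr rfl fun s hs => ?_
  have hs := (hx.mem_jumpTimes.1 hs).2
  obtain ⟨k, hk⟩ := hx.mem_states s
  obtain ⟨j, hj⟩ := hx.pre_mem_states s
  have hjk : k ≠ j := by
    rintro rfl
    exact hs (hj.trans hk.symm)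
  rw [Finset.sum_eq_single_of_mem j (Finset.mem_univ _),
    Finset.sum_eq_single_of_mem k (Finset.mem_erase.2 ⟨hjk, Finset.mem_univ _⟩)]
  · simp [hj, hk]
  · intro i _ hi
    simp [hk, hi.symm]
  · intro i _ hi
    refine Finset.sum_eq_zero fun _ _ => ?_
    simp [hj, hi.symm]

end IsStepPath

/-- The component `e_k^* A_s X_{s-}` of the drift of the chain. -/
def drift (A : ℝ≥0 → Matrix (Fin N) (Fin N) ℝ) (X : ℝ≥0 → Ω → Fin N → ℝ) (k : Fin N)
    (p : ℝ≥0 × Ω) : ℝ := (A p.1 *ᵥ pre (X · p.2) p.1) k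

namespace IsMarkovChain

variable (hX : IsMarkovChain P X A)
include hX

omit [IsProbabilityMeasure P] in
theorem isStepPath (ω : Ω) : IsStepPath (X · ω) :=
  ⟨fun t => hX.mem_states t ω, hX.right_cont ω, hX.left_lim ω⟩

omit [IsProbabilityMeasure P] in
theorem measurable_uncurry : Measurable fun p : ℝ≥0 × Ω => X p.1 p.2 :=
  measurable_uncurry_of_isStepPath hX.measurable hX.isStepPath

omit [IsProbabilityMeasure P] in
theorem measurable_pre : Measurable fun p : ℝ≥0 × Ω => pre (X · p.2) p.1 :=
  measurable_uncurry_pre hX.measurable hX.isStepPath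

omit [IsProbabilityMeasure P] in
theorem measurable_drift (k : Fin N) : Measurable (drift A X k) := by
  have h : drift A X k = fun p => ∑ l, A p.1 k l * pre (X · p.2) p.1 l := by
    ext p; simp [drift, Matrix.mulVec, dotProduct]
  rw [h]
  exact Finset.measurable_fun_sum _ fun l _ => ((hX.rate.measurable k l).comp measurable_fst).mul
    ((measurable_pi_apply l).comp hX.measurable_pre)

omit [IsProbabilityMeasure P] in
theorem exists_drift_bound : ∃ C : ℝ, 0 ≤ C ∧ ∀ k p, |drift A X k p| ≤ C := by
  obtain ⟨C, hC⟩ := hX.rate.bounded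
  refine ⟨max C 0, le_max_right _ _, fun k p => ?_⟩
  obtain ⟨j, hj⟩ := (hX.isStepPath p.2).pre_mem_states p.1
  rw [drift, hj, mulVec_e]
  exact (hC _ _ _).trans (le_max_left _ _)

omit [IsProbabilityMeasure P] in
theorem integrableOn_drift (k : Fin N) (ω : Ω) (a b : ℝ≥0) :
    IntegrableOn (fun s => drift A X k (s, ω)) (Set.Ioc a b) leb := by
  obtain ⟨C, -, hC⟩ := hX.exists_drift_bound
  exact integrableOn_leb_of_bounded ((hX.measurable_drift k).comp measurable_prodMk_right)
    fun s => hC k (s, ω)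

omit [IsProbabilityMeasure P] in
theorem martingalePart_apply (t : ℝ≥0) (ω : Ω) (k : Fin N) :
    martingalePart A X t ω k = X t ω k - X 0 ω k - ∫ s in Set.Ioc 0 t, drift A X k (s, ω) ∂leb := by
  rw [martingalePart, Pi.sub_apply, Pi.sub_apply, eval_integral]
  · rfl
  · exact fun k => hX.integrableOn_drift k ω 0 t

omit [IsProbabilityMeasure P] in
theorem measurable_setIntegral_drift (k : Fin N) (a b : ℝ≥0) :
    Measurable fun ω => ∫ s in Set.Ioc a b, drift A X k (s, ω) ∂leb :=
  (StronglyMeasurable.integral_prod_right' (f := fun q : Ω × ℝ≥0 => drift A X k (q.2, q.1))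
    ((hX.measurable_drift k).comp measurable_swap).stronglyMeasurable).measurable

theorem integrable_setIntegral_drift (k : Fin N) {a b : ℝ≥0} (hab : a ≤ b) :
    Integrable (fun ω => ∫ s in Set.Ioc a b, drift A X k (s, ω) ∂leb) P := by
  obtain ⟨C, -, hC⟩ := hX.exists_drift_bound
  exact Integrable.of_bound (hX.measurable_setIntegral_drift k a b).aestronglyMeasurable
    (C * (b - a)) (Eventually.of_forall fun ω => abs_setIntegral_leb_le hab fun s _ => hC k (s, ω))

theorem integrable_apply (t : ℝ≥0) (k : Fin N) : Integrable (fun ω => X t ω k) P := by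
  refine Integrable.of_bound ((measurable_pi_apply k).comp (hX.measurable t)).aestronglyMeasurable
    1 (Eventually.of_forall fun ω => ?_)
  obtain ⟨i, hi⟩ := hX.mem_states t ω
  rw [hi, e, Pi.single_apply]
  split_ifs <;> simp

/-- The martingale property of the `k`-th component, tested on an event known at time `s`. -/
theorem setIntegral_sub {s t : ℝ≥0} (hst : s ≤ t) {B : Set Ω}
    (hB : MeasurableSet[chainFiltration P X hX.measurable s] B) (k : Fin N) :
    ∫ ω in B, (X t ω k - X s ω k) ∂P =
      ∫ ω in B, (∫ r in Set.Ioc s t, drift A X k (r, ω) ∂leb) ∂P := by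
  have h1 := hX.martingale.setIntegral_eq hst hB
  have hint : ∀ (r : ℝ≥0) (i : Fin N), Integrable (fun ω => martingalePart A X r ω i)
      (P.restrict B) := fun r i => (Integrable.eval (hX.martingale.integrable r) i).restrict
  have h2 := congrFun h1 k
  rw [eval_integral (hint s), eval_integral (hint t), ← sub_eq_zero, ← integral_sub (hint s k)
    (hint t k)] at h2
  have h3 : ∀ ω, martingalePart A X s ω k - martingalePart A X t ω k =
      (∫ r in Set.Ioc s t, drift A X k (r, ω) ∂leb) - (X t ω k - X s ω k) := fun ω => by
    rw [hX.martingalePart_apply, hX.martingalePart_apply, ← Set.Ioc_union_Ioc_eq_Ioc zero_le hst,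
      setIntegral_union (Set.Ioc_disjoint_Ioc_of_le le_rfl) measurableSet_Ioc
        (hX.integrableOn_drift k ω _ _) (hX.integrableOn_drift k ω _ _)]
    ring
  simp_rw [h3] at h2
  have h4 : Integrable (fun ω => X t ω k - X s ω k) P :=
    (hX.integrable_apply t k).sub (hX.integrable_apply s k)
  rw [integral_sub (hX.integrable_setIntegral_drift k hst).restrict h4.restrict,
    sub_eq_zero] at h2
  exact h2.symm

omit [IsProbabilityMeasure P] in
theorem measurableSet_state (t : ℝ≥0) (j : Fin N) :
    MeasurableSet[chainFiltration P X hX.measurable t] {ω | X t ω = e j} := by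
  refine le_sup_left (a := ⨆ s ≤ t, MeasurableSpace.comap (X s) inferInstance) _ ?_
  refine le_iSup₂ (f := fun s (_ : s ≤ t) => MeasurableSpace.comap (X s) inferInstance) t le_rfl _ ?_
  exact ⟨{e j}, measurableSet_singleton _, rfl⟩

omit [IsProbabilityMeasure P] in
theorem measurableSet_state' (t : ℝ≥0) (j : Fin N) : MeasurableSet {ω | X t ω = e j} :=
  hX.measurable t (measurableSet_singleton _)

omit [IsProbabilityMeasure P] in
theorem setIntegral_stepApprox {a b : ℝ≥0} (hab : a ≤ b) (n : ℕ) (φ : ℝ≥0 → ℝ) (k : Fin N)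
    (ω : Ω) :
    ∫ s in Set.Ioc a b, stepApprox a b n φ s * drift A X k (s, ω) ∂leb =
      ∑ m ∈ Finset.range (n + 1), φ (gridPoint a b n m) *
        ∫ s in Set.Ioc (gridPoint a b n m) (gridPoint a b n (m + 1)), drift A X k (s, ω) ∂leb := by
  have h1 : ∀ s, stepApprox a b n φ s * drift A X k (s, ω) = ∑ m ∈ Finset.range (n + 1),
      (Set.Ioc (gridPoint a b n m) (gridPoint a b n (m + 1))).indicator
        (fun s => φ (gridPoint a b n m) * drift A X k (s, ω)) s := fun s => by
    rw [stepApprox, Finset.sum_mul]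
    refine Finset.sum_congr rfl fun m _ => ?_
    rw [Set.indicator_apply, Set.indicator_apply]
    split_ifs <;> simp
  simp_rw [h1]
  rw [integral_finsetSum _ fun m _ =>
    (Integrable.const_mul (hX.integrableOn_drift k ω a b) _).indicator measurableSet_Ioc]
  refine Finset.sum_congr rfl fun m hm => ?_
  rw [setIntegral_indicator measurableSet_Ioc, integral_const_mul, Set.inter_eq_right.2]
  refine Set.Ioc_subset_Ioc ?_ ?_
  · simp [gridPoint]
  · conv_rhs => rw [← gridPoint_last hab n]
    exact gridPoint_mono a b n (by simpa using hm)

omit [IsProbabilityMeasure P] in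
theorem measurable_transitionSum (a b : ℝ≥0) (j k : Fin N) (n : ℕ) :
    Measurable fun ω => transitionSum (X · ω) a b j k n := by
  refine Finset.measurable_fun_sum _ fun m _ => ?_
  refine Measurable.mul ?_ (((measurable_pi_apply k).comp (hX.measurable _)).sub
    ((measurable_pi_apply k).comp (hX.measurable _)))
  exact measurable_const.indicator (hX.measurableSet_state' (gridPoint a b n m) j)

/-- The weight `1{X_{t_m} = e_j}` is known at the left end of its cell, so `setIntegral_sub` applies
to each cell with the event `B ∩ {X_{t_m} = e_j}`. -/
theorem setIntegral_transitionSum {a b : ℝ≥0} (hab : a ≤ b) {B : Set Ω}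
    (hB : MeasurableSet[chainFiltration P X hX.measurable a] B) (j k : Fin N) (n : ℕ) :
    ∫ ω in B, transitionSum (X · ω) a b j k n ∂P =
      ∫ ω in B, (∫ s in Set.Ioc a b, stepApprox a b n
        (Set.indicator {r | X r ω = e j} (fun _ => (1 : ℝ))) s * drift A X k (s, ω) ∂leb) ∂P := by
  have hind : ∀ (m : ℕ) (ω : Ω) (g : Ω → ℝ), Set.indicator {r | X r ω = e j} (fun _ => (1 : ℝ))
      (gridPoint a b n m) * g ω = Set.indicator {ω | X (gridPoint a b n m) ω = e j} g ω := by
    intro m ω g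
    rw [Set.indicator_apply, Set.indicator_apply]
    simp
  have h1 : ∀ ω, transitionSum (X · ω) a b j k n = ∑ m ∈ Finset.range (n + 1),
      Set.indicator {ω | X (gridPoint a b n m) ω = e j}
        (fun ω => X (gridPoint a b n (m + 1)) ω k - X (gridPoint a b n m) ω k) ω := fun ω =>
    Finset.sum_congr rfl fun m _ => hind m ω
      (fun ω => X (gridPoint a b n (m + 1)) ω k - X (gridPoint a b n m) ω k)
  have h2 : ∀ ω, ∫ s in Set.Ioc a b, stepApprox a b n
        (Set.indicator {r | X r ω = e j} (fun _ => (1 : ℝ))) s * drift A X k (s, ω) ∂leb =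
      ∑ m ∈ Finset.range (n + 1), Set.indicator {ω | X (gridPoint a b n m) ω = e j}
        (fun ω => ∫ s in Set.Ioc (gridPoint a b n m) (gridPoint a b n (m + 1)),
          drift A X k (s, ω) ∂leb) ω := fun ω => by
    rw [hX.setIntegral_stepApprox hab]
    exact Finset.sum_congr rfl fun m _ => hind m ω (fun ω => ∫ s in Set.Ioc (gridPoint a b n m)
      (gridPoint a b n (m + 1)), drift A X k (s, ω) ∂leb)
  simp_rw [h1, h2]
  rw [integral_finsetSum, integral_finsetSum]
  · refine Finset.sum_congr rfl fun m _ => ?_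
    rw [setIntegral_indicator (hX.measurableSet_state' _ _),
      setIntegral_indicator (hX.measurableSet_state' _ _)]
    refine hX.setIntegral_sub (gridPoint_mono a b n m.le_succ) ?_ k
    refine MeasurableSet.inter ?_ (hX.measurableSet_state _ _)
    exact (chainFiltration P X hX.measurable).mono (by simp [gridPoint]) _ hB
  · intro m _
    exact ((hX.integrable_setIntegral_drift k (gridPoint_mono a b n m.le_succ)).restrict).indicator
      (hX.measurableSet_state' _ _)
  · intro m _
    exact (((hX.integrable_apply _ k).sub (hX.integrable_apply _ k)).restrict).indicator
      (hX.measurableSet_state' _ _)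

end IsMarkovChain

end

end MarkovBSDE

/-! ### The compensator of the jump counts over predictable sets. -/

namespace MarkovBSDE

noncomputable section

theorem measurable_stepApprox (a b : ℝ≥0) (n : ℕ) (φ : ℝ≥0 → ℝ) :
    Measurable (stepApprox a b n φ) :=
  Finset.measurable_fun_sum _ fun _ _ => measurable_const.indicator measurableSet_Ioc

theorem predictable_le {Ω : Type*} {mΩ : MeasurableSpace Ω} (ℱ : Filtration ℝ≥0 mΩ) :
    ℱ.predictable ≤ (inferInstance : MeasurableSpace (ℝ≥0 × Ω)) :=
  measurableSpace_le_predictable_of_measurableSet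
    (fun _ hA => (measurableSet_singleton _).prod (ℱ.le _ _ hA))
    (fun _ _ hA => measurableSet_Ioi.prod (ℱ.le _ _ hA))

variable {N : ℕ} {Ω : Type*} [mΩ : MeasurableSpace Ω] {P : Measure Ω}
  {X : ℝ≥0 → Ω → Fin N → ℝ} {A : ℝ≥0 → Matrix (Fin N) (Fin N) ℝ}

/-- The intensity `1{X_{s-} = e_j} (A_s)_{kj}` of jumps from `e j` to `e k`. -/
def jumpRate (A : ℝ≥0 → Matrix (Fin N) (Fin N) ℝ) (X : ℝ≥0 → Ω → Fin N → ℝ) (j k : Fin N)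
    (p : ℝ≥0 × Ω) : ℝ :=
  Set.indicator {p : ℝ≥0 × Ω | pre (X · p.2) p.1 = e j} (fun p => A p.1 k j) p

/-- The number of jumps from `e j` to `e k` at times `s ≤ b` with `(s, ω) ∈ D`. -/
def jumpCount (X : ℝ≥0 → Ω → Fin N → ℝ) (b : ℝ≥0) (j k : Fin N) (D : Set (ℝ≥0 × Ω)) (ω : Ω) :
    ℝ≥0∞ :=
  ∑ s ∈ jumpTimes (X · ω) b,
    Set.indicator {p : ℝ≥0 × Ω | pre (X · p.2) p.1 = e j ∧ X p.1 p.2 = e k}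
      (D.indicator fun _ => 1) (s, ω)

omit mΩ in
theorem jumpRate_eq (j k : Fin N) (p : ℝ≥0 × Ω) : jumpRate A X j k p =
    (if pre (X · p.2) p.1 = e j then 1 else 0) * drift A X k p := by
  rw [jumpRate, Set.indicator_apply]
  simp only [Set.mem_ofPred_eq]
  split_ifs with h
  · rw [drift, h, mulVec_e, one_mul]
  · simp

omit mΩ in
theorem abs_stepApprox_mul_drift_le {C : ℝ} (hC : ∀ k p, |drift A X k p| ≤ C) {a b s : ℝ≥0}
    (hs : s ∈ Set.Ioc a b) (n : ℕ) (j k : Fin N) (ω : Ω) :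
    |stepApprox a b n (Set.indicator {r | X r ω = e j} (fun _ => (1 : ℝ))) s * drift A X k (s, ω)|
      ≤ C := by
  rw [abs_mul]
  refine (mul_le_of_le_one_left (abs_nonneg _) (abs_stepApprox_le n hs fun r => ?_)).trans (hC _ _)
  rw [Set.indicator_apply]
  split_ifs <;> simp

omit mΩ in
theorem jumpCount_Ioi_prod {a b : ℝ≥0} (B : Set Ω) (j k : Fin N) (ω : Ω) :
    jumpCount X b j k (Set.Ioi a ×ˢ B) ω =
      B.indicator (fun ω => ENNReal.ofReal (jumpSum (X · ω) a b j k)) ω := by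
  by_cases h : ω ∈ B
  · rw [jumpCount, Set.indicator_of_mem h, jumpSum, ENNReal.ofReal_sum_of_nonneg
      fun s _ => Set.indicator_nonneg (fun _ _ => zero_le_one) _, Finset.sum_filter]
    refine Finset.sum_congr rfl fun s _ => ?_
    simp only [Set.indicator_apply, Set.mem_ofPred_eq]
    split_ifs <;> simp_all
  · rw [Set.indicator_of_notMem h]
    refine Finset.sum_eq_zero fun s _ => ?_
    simp [h]

namespace IsMarkovChain

variable (hX : IsMarkovChain P X A)
include hX

theorem measurable_jumpSum {a b : ℝ≥0} (hab : a ≤ b) {j k : Fin N} (hjk : j ≠ k) :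
    Measurable fun ω => jumpSum (X · ω) a b j k :=
  measurable_of_tendsto_metrizable (fun n => hX.measurable_transitionSum a b j k n)
    (tendsto_pi_nhds.2 fun ω => (hX.isStepPath ω).tendsto_transitionSum hab hjk)

theorem measurable_jumpRate (j k : Fin N) : Measurable (jumpRate A X j k) :=
  ((hX.rate.measurable k j).comp measurable_fst).indicator
    (hX.measurable_pre (measurableSet_singleton _))

theorem jumpRate_nonneg {j k : Fin N} (hjk : j ≠ k) (p : ℝ≥0 × Ω) : 0 ≤ jumpRate A X j k p :=
  Set.indicator_nonneg (fun _ _ => hX.rate.nonneg _ _ _ hjk.symm) _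

theorem exists_jumpRate_bound : ∃ C : ℝ, ∀ j k p, |jumpRate A X j k p| ≤ C := by
  obtain ⟨C, hC0, hC⟩ := hX.exists_drift_bound
  refine ⟨C, fun j k p => ?_⟩
  rw [jumpRate_eq]
  split_ifs
  · rw [one_mul]; exact hC k p
  · simpa using hC0

theorem tendsto_setIntegral_stepApprox (a b : ℝ≥0) (j k : Fin N) (ω : Ω) :
    Tendsto (fun n => ∫ s in Set.Ioc a b, stepApprox a b n
        (Set.indicator {r | X r ω = e j} (fun _ => (1 : ℝ))) s * drift A X k (s, ω) ∂leb) atTop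
      (𝓝 (∫ s in Set.Ioc a b, jumpRate A X j k (s, ω) ∂leb)) := by
  obtain ⟨C, hC0, hC⟩ := hX.exists_drift_bound
  refine tendsto_integral_of_dominated_convergence (fun _ => C) (fun n => ?_) ?_ (fun n => ?_) ?_
  · exact ((measurable_stepApprox a b n _).mul
      ((hX.measurable_drift k).comp measurable_prodMk_right)).aestronglyMeasurable
  · exact integrableOn_const (by simp [leb_Ioc])
  · filter_upwards [ae_restrict_mem measurableSet_Ioc] with s hs
    exact abs_stepApprox_mul_drift_le hC hs n j k ω
  · filter_upwards [ae_restrict_mem measurableSet_Ioc] with s hs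
    rw [jumpRate_eq]
    refine Tendsto.mul_const _ (tendsto_nhds_of_eventually_eq (eventually_stepApprox_eq hs ?_))
    filter_upwards [(hX.isStepPath ω).eventually_left s] with r hr
    simp [Set.indicator_apply, hr]

variable [IsProbabilityMeasure P]

theorem integrable_transitionSum (a b : ℝ≥0) (j k : Fin N) (n : ℕ) :
    Integrable (fun ω => transitionSum (X · ω) a b j k n) P := by
  refine integrable_finsetSum _ fun m _ => ?_
  have h : Integrable (fun ω => X (gridPoint a b n (m + 1)) ω k - X (gridPoint a b n m) ω k) P :=
    (hX.integrable_apply _ k).sub (hX.integrable_apply _ k)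
  refine Integrable.bdd_mul (c := 1) h
    (measurable_const.indicator (hX.measurableSet_state' (gridPoint a b n m) j)).aestronglyMeasurable
    (Eventually.of_forall fun ω => ?_)
  rw [Set.indicator_apply]
  split_ifs <;> simp

/-- Fatou: the nonnegative Riemann sums have expectations equal to those of drift integrals, bounded
by `C * b` uniformly in `n`. -/
theorem integrable_jumpSum {b : ℝ≥0} {j k : Fin N} (hjk : j ≠ k) :
    Integrable (fun ω => jumpSum (X · ω) 0 b j k) P := by
  obtain ⟨C, hC0, hC⟩ := hX.exists_drift_bound
  refine ⟨(hX.measurable_jumpSum zero_le hjk).aestronglyMeasurable, ?_⟩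
  rw [hasFiniteIntegral_iff_enorm]
  have h1 : ∀ ω, Tendsto (fun n => ‖transitionSum (X · ω) 0 b j k n‖ₑ) atTop
      (𝓝 ‖jumpSum (X · ω) 0 b j k‖ₑ) := fun ω =>
    ((hX.isStepPath ω).tendsto_transitionSum zero_le hjk).enorm
  have h2 : ∀ n, ∫⁻ ω, ‖transitionSum (X · ω) 0 b j k n‖ₑ ∂P ≤ ENNReal.ofReal (C * b) := by
    intro n
    have hn : ∀ ω, ‖transitionSum (X · ω) 0 b j k n‖ₑ =
        ENNReal.ofReal (transitionSum (X · ω) 0 b j k n) := fun ω =>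
      Real.enorm_of_nonneg ((hX.isStepPath ω).transitionSum_nonneg hjk n)
    simp_rw [hn]
    rw [← ofReal_integral_eq_lintegral_ofReal (hX.integrable_transitionSum 0 b j k n)
      (Eventually.of_forall fun ω => (hX.isStepPath ω).transitionSum_nonneg hjk n)]
    refine ENNReal.ofReal_le_ofReal ?_
    have h3 := hX.setIntegral_transitionSum (zero_le (a := b)) MeasurableSet.univ j k n
    rw [setIntegral_univ, setIntegral_univ] at h3
    rw [h3]
    have h4 := norm_integral_le_of_norm_le_const (μ := P) (C := C * b)
      (f := fun ω => ∫ s in Set.Ioc 0 b, stepApprox 0 b n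
        (Set.indicator {r | X r ω = e j} (fun _ => (1 : ℝ))) s * drift A X k (s, ω) ∂leb)
      (Eventually.of_forall fun ω => by
        simpa using abs_setIntegral_leb_le (zero_le (a := b)) fun s hs =>
          abs_stepApprox_mul_drift_le hC hs n j k ω)
    rw [probReal_univ, mul_one] at h4
    exact (le_abs_self _).trans h4
  calc ∫⁻ ω, ‖jumpSum (X · ω) 0 b j k‖ₑ ∂P
      = ∫⁻ ω, liminf (fun n => ‖transitionSum (X · ω) 0 b j k n‖ₑ) atTop ∂P :=
        lintegral_congr fun ω => (h1 ω).liminf_eq.symm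
    _ ≤ liminf (fun n => ∫⁻ ω, ‖transitionSum (X · ω) 0 b j k n‖ₑ ∂P) atTop :=
        lintegral_liminf_le fun n => (hX.measurable_transitionSum 0 b j k n).enorm
    _ ≤ ENNReal.ofReal (C * b) := liminf_le_of_le (by isBoundedDefault) fun c hc => by
        obtain ⟨n, hn⟩ := hc.exists
        exact hn.trans (h2 n)
    _ < ∞ := ENNReal.ofReal_lt_top

theorem integrable_card_jumpTimes (b : ℝ≥0) :
    Integrable (fun ω => ((jumpTimes (X · ω) b).card : ℝ)) P := by
  simp_rw [fun ω => (hX.isStepPath ω).card_jumpTimes b]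
  exact integrable_finsetSum _ fun j _ => integrable_finsetSum _ fun k hk =>
    hX.integrable_jumpSum (Finset.ne_of_mem_erase hk).symm

/-- Both sides of `setIntegral_transitionSum` converge by domination: the left by the number of
jumps, the right by a constant. -/
theorem setIntegral_jumpSum {a b : ℝ≥0} (hab : a ≤ b) {B : Set Ω}
    (hB : MeasurableSet[chainFiltration P X hX.measurable a] B) {j k : Fin N} (hjk : j ≠ k) :
    ∫ ω in B, jumpSum (X · ω) a b j k ∂P =
      ∫ ω in B, (∫ s in Set.Ioc a b, jumpRate A X j k (s, ω) ∂leb) ∂P := by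
  obtain ⟨C, hC0, hC⟩ := hX.exists_drift_bound
  have h1 : Tendsto (fun n => ∫ ω in B, transitionSum (X · ω) a b j k n ∂P) atTop
      (𝓝 (∫ ω in B, jumpSum (X · ω) a b j k ∂P)) := by
    refine tendsto_integral_of_dominated_convergence
      (fun ω => ((jumpTimes (X · ω) b).card : ℝ)) (fun n => ?_) ?_ (fun n => ?_) ?_
    · exact (hX.measurable_transitionSum a b j k n).aestronglyMeasurable
    · exact (hX.integrable_card_jumpTimes b).restrict
    · exact Eventually.of_forall fun ω => (hX.isStepPath ω).abs_transitionSum_le hab j k n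
    · exact Eventually.of_forall fun ω => (hX.isStepPath ω).tendsto_transitionSum hab hjk
  refine tendsto_nhds_unique h1 ?_
  simp_rw [hX.setIntegral_transitionSum hab hB]
  refine tendsto_integral_of_dominated_convergence (fun _ => C * (b - a)) (fun n => ?_) ?_
    (fun n => ?_) ?_
  · simp_rw [hX.setIntegral_stepApprox hab]
    refine (Finset.measurable_fun_sum _ fun m _ => ?_).aestronglyMeasurable
    exact (measurable_const.indicator (hX.measurableSet_state' (gridPoint a b n m) j)).mul
      (hX.measurable_setIntegral_drift k _ _)
  · exact integrable_const _
  · exact Eventually.of_forall fun ω => abs_setIntegral_leb_le hab fun s hs =>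
      abs_stepApprox_mul_drift_le hC hs n j k ω
  · exact Eventually.of_forall fun ω => hX.tendsto_setIntegral_stepApprox a b j k ω

theorem setLIntegral_jumpSum {a b : ℝ≥0} (hab : a ≤ b) {B : Set Ω}
    (hB : MeasurableSet[chainFiltration P X hX.measurable a] B) {j k : Fin N} (hjk : j ≠ k) :
    ∫⁻ ω in B, ENNReal.ofReal (jumpSum (X · ω) a b j k) ∂P =
      ∫⁻ ω in B, (∫⁻ s in Set.Ioc a b, ENNReal.ofReal (jumpRate A X j k (s, ω)) ∂leb) ∂P := by
  obtain ⟨C, hC⟩ := hX.exists_jumpRate_bound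
  have h0 : ∀ ω, 0 ≤ jumpSum (X · ω) a b j k := fun ω =>
    Finset.sum_nonneg fun s _ => Set.indicator_nonneg (fun _ _ => zero_le_one) _
  have h1 : Integrable (fun ω => jumpSum (X · ω) a b j k) P := by
    refine (hX.integrable_card_jumpTimes b).mono' (hX.measurable_jumpSum hab hjk).aestronglyMeasurable
      (Eventually.of_forall fun ω => ?_)
    rw [Real.norm_of_nonneg (h0 ω)]
    refine (Finset.sum_le_card_nsmul _ _ 1 fun s _ => ?_).trans ?_
    · rw [Set.indicator_apply]
      split_ifs <;> simp
    · rw [nsmul_eq_mul, mul_one]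
      exact_mod_cast Finset.card_filter_le _ _
  have h2 : ∀ ω, ∫⁻ s in Set.Ioc a b, ENNReal.ofReal (jumpRate A X j k (s, ω)) ∂leb =
      ENNReal.ofReal (∫ s in Set.Ioc a b, jumpRate A X j k (s, ω) ∂leb) := fun ω =>
    (ofReal_integral_eq_lintegral_ofReal (integrableOn_leb_of_bounded
      ((hX.measurable_jumpRate j k).comp measurable_prodMk_right) fun s => hC j k (s, ω))
      (Eventually.of_forall fun s => hX.jumpRate_nonneg hjk _)).symm
  have h3 : Measurable fun ω => ∫ s in Set.Ioc a b, jumpRate A X j k (s, ω) ∂leb :=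
    (StronglyMeasurable.integral_prod_right' (f := fun q : Ω × ℝ≥0 => jumpRate A X j k (q.2, q.1))
      ((hX.measurable_jumpRate j k).comp measurable_swap).stronglyMeasurable).measurable
  simp_rw [h2]
  rw [← ofReal_integral_eq_lintegral_ofReal h1.restrict (Eventually.of_forall h0),
    hX.setIntegral_jumpSum hab hB hjk, ofReal_integral_eq_lintegral_ofReal]
  · exact (Integrable.of_bound h3.aestronglyMeasurable (C * (b - a)) (Eventually.of_forall fun ω =>
      abs_setIntegral_leb_le hab fun s _ => hC j k (s, ω))).restrict
  · exact Eventually.of_forall fun ω => integral_nonneg fun s => hX.jumpRate_nonneg hjk _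

/-- The sets `]a, ∞[ × B` with `B ∈ ℱ_a` and `{0} × B` with `B ∈ ℱ_0` form a π-system generating the
predictable σ-algebra. The first kind is `setLIntegral_jumpSum`, the second carries no jumps and no
mass. Measurability of the count is part of the induction. -/
theorem jumpCount_compensator (b : ℝ≥0) {j k : Fin N} (hjk : j ≠ k) {D : Set (ℝ≥0 × Ω)}
    (hD : MeasurableSet[(chainFiltration P X hX.measurable).predictable] D) :
    Measurable (jumpCount X b j k D) ∧ ∫⁻ ω, jumpCount X b j k D ω ∂P =
      ∫⁻ p in D, ENNReal.ofReal (jumpRate A X j k p) ∂((leb.restrict (Set.Ioc 0 b)).prod P) := by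
  have hle := predictable_le (chainFiltration P X hX.measurable)
  obtain ⟨C, hC⟩ := hX.exists_jumpRate_bound
  have : IsFiniteMeasure (leb.restrict (Set.Ioc 0 b)) := ⟨by simp [leb_Ioc]⟩
  set μ := (leb.restrict (Set.Ioc 0 b)).prod P with hμ
  have hmr : Measurable fun p => ENNReal.ofReal (jumpRate A X j k p) :=
    (hX.measurable_jumpRate j k).ennreal_ofReal
  have hbase : ∀ (a : ℝ≥0) (B : Set Ω), MeasurableSet[chainFiltration P X hX.measurable a] B →
      Measurable (jumpCount X b j k (Set.Ioi a ×ˢ B)) ∧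
      ∫⁻ ω, jumpCount X b j k (Set.Ioi a ×ˢ B) ω ∂P =
      ∫⁻ p in Set.Ioi a ×ˢ B, ENNReal.ofReal (jumpRate A X j k p) ∂μ := by
    intro a B hB
    have hB' := (chainFiltration P X hX.measurable).le a _ hB
    rcases le_or_gt a b with hab | hab
    · have h1 : jumpCount X b j k (Set.Ioi a ×ˢ B) = _ :=
        funext fun ω => jumpCount_Ioi_prod B j k ω
      rw [h1]
      refine ⟨(hX.measurable_jumpSum hab hjk).ennreal_ofReal.indicator hB', ?_⟩
      rw [lintegral_indicator hB', hX.setLIntegral_jumpSum hab hB hjk, hμ, ← Measure.prod_restrict,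
        lintegral_prod_symm _ hmr.aemeasurable, Measure.restrict_restrict measurableSet_Ioi]
      have : Set.Ioi a ∩ Set.Ioc 0 b = Set.Ioc a b := by
        ext s; exact ⟨fun h => ⟨h.1, h.2.2⟩, fun h => ⟨h.1, bot_lt_of_lt h.1, h.2⟩⟩
      rw [this]
    · have h1 : jumpCount X b j k (Set.Ioi a ×ˢ B) = fun _ => 0 := by
        ext ω
        refine Finset.sum_eq_zero fun s hs => ?_
        rw [(hX.isStepPath ω).mem_jumpTimes] at hs
        have : (s, ω) ∉ Set.Ioi a ×ˢ B := fun h => absurd (hs.1.2.trans_lt hab) h.1.le.not_gt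
        exact Set.indicator_apply_eq_zero.2 fun _ => Set.indicator_of_notMem this _
      rw [h1]
      refine ⟨measurable_const, ?_⟩
      have : Set.Ioi a ∩ Set.Ioc 0 b = ∅ := by
        ext s
        simp only [Set.mem_inter_iff, Set.mem_Ioi, Set.mem_Ioc, Set.mem_empty_iff_false, iff_false]
        exact fun h => absurd (h.2.2.trans_lt hab) h.1.le.not_gt
      rw [hμ, ← Measure.prod_restrict, Measure.restrict_restrict measurableSet_Ioi, this]
      simp
  have hzero : ∀ (B : Set Ω), MeasurableSet[chainFiltration P X hX.measurable ⊥] B →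
      Measurable (jumpCount X b j k ({⊥} ×ˢ B)) ∧ ∫⁻ ω, jumpCount X b j k ({⊥} ×ˢ B) ω ∂P =
      ∫⁻ p in {⊥} ×ˢ B, ENNReal.ofReal (jumpRate A X j k p) ∂μ := by
    intro B _
    have h1 : jumpCount X b j k ({⊥} ×ˢ B) = fun _ => 0 := by
      ext ω
      refine Finset.sum_eq_zero fun s hs => ?_
      rw [(hX.isStepPath ω).mem_jumpTimes] at hs
      have : (s, ω) ∉ ({⊥} : Set ℝ≥0) ×ˢ B := fun h => hs.1.1.ne' h.1
      exact Set.indicator_apply_eq_zero.2 fun _ => Set.indicator_of_notMem this _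
    rw [h1]
    refine ⟨measurable_const, ?_⟩
    rw [hμ, ← Measure.prod_restrict, Measure.restrict_restrict (measurableSet_singleton _)]
    have : ({⊥} : Set ℝ≥0) ∩ Set.Ioc 0 b = ∅ := by
      ext s
      simp only [Set.mem_inter_iff, Set.mem_singleton_iff, Set.mem_Ioc, Set.mem_empty_iff_false,
        iff_false]
      exact fun h => h.2.1.ne' h.1
    rw [this]
    simp
  -- Finiteness permits the subtraction in `ℝ≥0∞` when passing to complements.
  have hfin : ∀ D, ∫⁻ p in D, ENNReal.ofReal (jumpRate A X j k p) ∂μ ≠ ∞ := by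
    intro D
    refine ((lintegral_mono fun p => ENNReal.ofReal_le_ofReal
      ((le_abs_self _).trans (hC j k p))).trans_lt ?_).ne
    rw [lintegral_const]
    exact ENNReal.mul_lt_top ENNReal.ofReal_lt_top (measure_lt_top _ _)
  have huniv : Measurable (jumpCount X b j k Set.univ) ∧ ∫⁻ ω, jumpCount X b j k Set.univ ω ∂P =
      ∫⁻ p, ENNReal.ofReal (jumpRate A X j k p) ∂μ := by
    have h := hbase 0 Set.univ MeasurableSet.univ
    have h1 : jumpCount X b j k (Set.Ioi 0 ×ˢ Set.univ) = jumpCount X b j k Set.univ := by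
      ext ω
      refine Finset.sum_congr rfl fun s hs => ?_
      rw [(hX.isStepPath ω).mem_jumpTimes] at hs
      simp [Set.indicator_apply, hs.1.1]
    rw [h1] at h
    refine ⟨h.1, h.2.trans ?_⟩
    rw [hμ, ← Measure.prod_restrict, Measure.restrict_restrict measurableSet_Ioi,
      Measure.restrict_univ]
    have : Set.Ioi 0 ∩ Set.Ioc 0 b = Set.Ioc 0 b :=
      Set.inter_eq_right.2 fun s hs => hs.1
    rw [this]
  refine MeasurableSpace.induction_on_inter (C := fun D _ => Measurable (jumpCount X b j k D) ∧
    ∫⁻ ω, jumpCount X b j k D ω ∂P = ∫⁻ p in D, ENNReal.ofReal (jumpRate A X j k p) ∂μ)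
    (m := (chainFiltration P X hX.measurable).predictable) rfl ?_ ?_ ?_ ?_ ?_ D hD
  · rintro s hs t ht -
    rcases hs with ⟨B, hB, rfl⟩ | ⟨a, B, hB, rfl⟩ <;> rcases ht with ⟨B', hB', rfl⟩ | ⟨a', B', hB', rfl⟩
    · exact Or.inl ⟨B ∩ B', hB.inter hB', by rw [Set.prod_inter_prod, Set.inter_self]⟩
    · refine Or.inl ⟨∅, (chainFiltration P X hX.measurable ⊥).measurableSet_empty, ?_⟩
      rw [Set.prod_inter_prod]
      simp
    · refine Or.inl ⟨∅, (chainFiltration P X hX.measurable ⊥).measurableSet_empty, ?_⟩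
      rw [Set.prod_inter_prod]
      simp
    · refine Or.inr ⟨a ⊔ a', B ∩ B', ?_, ?_⟩
      · exact ((chainFiltration P X hX.measurable).mono le_sup_left _ hB).inter
          ((chainFiltration P X hX.measurable).mono le_sup_right _ hB')
      · rw [Set.prod_inter_prod, Set.Ioi_inter_Ioi]
  · have : jumpCount X b j k ∅ = fun _ => 0 := by
      ext ω; exact Finset.sum_eq_zero fun s _ => by simp
    rw [this]
    exact ⟨measurable_const, by simp⟩
  · rintro t (⟨B, hB, rfl⟩ | ⟨a, B, hB, rfl⟩)
    exacts [hzero B hB, hbase a B hB]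
  · rintro t ht ⟨h1, h2⟩
    have hadd : ∀ ω, jumpCount X b j k t ω + jumpCount X b j k tᶜ ω =
        jumpCount X b j k Set.univ ω := by
      intro ω
      rw [jumpCount, jumpCount, jumpCount, ← Finset.sum_add_distrib]
      refine Finset.sum_congr rfl fun s _ => ?_
      by_cases h : (s, ω) ∈ t <;> simp [Set.indicator_apply, h]
    have hne : ∀ ω, jumpCount X b j k t ω ≠ ∞ := fun ω => by
      classical
      rw [jumpCount]
      refine (ENNReal.sum_lt_top.2 fun s _ => ?_).ne
      simp only [Set.indicator_apply]
      split_ifs <;> simp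
    have heq : jumpCount X b j k tᶜ = fun ω => jumpCount X b j k Set.univ ω - jumpCount X b j k t ω := by
      ext ω
      rw [← hadd ω, ENNReal.add_sub_cancel_left (hne ω)]
    refine ⟨heq ▸ huniv.1.sub h1, ?_⟩
    rw [heq, lintegral_sub h1 (h2 ▸ hfin t)
      (Eventually.of_forall fun ω => hadd ω ▸ le_self_add), huniv.2, h2,
      ← lintegral_add_compl _ (hle _ ht), ENNReal.add_sub_cancel_left (hfin t)]
  · intro f hdisj hfm hC
    have heq : ∀ ω, jumpCount X b j k (⋃ i, f i) ω = ∑' i, jumpCount X b j k (f i) ω := by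
      intro ω
      simp only [jumpCount]
      rw [Summable.tsum_finsetSum fun _ _ => ENNReal.summable]
      refine Finset.sum_congr rfl fun s _ => ?_
      by_cases h : (s, ω) ∈ {p : ℝ≥0 × Ω | pre (X · p.2) p.1 = e j ∧ X p.1 p.2 = e k}
      · simp only [Set.indicator_of_mem h]
        by_cases hU : (s, ω) ∈ ⋃ i, f i
        · obtain ⟨i, hi⟩ := Set.mem_iUnion.1 hU
          rw [Set.indicator_of_mem hU, tsum_eq_single i, Set.indicator_of_mem hi]
          exact fun i' hi' => Set.indicator_of_notMem
            (fun h => Set.disjoint_left.1 (hdisj hi') h hi) _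
        · rw [Set.indicator_of_notMem hU]
          refine (ENNReal.tsum_eq_zero.2 fun i => Set.indicator_of_notMem ?_ _).symm
          exact fun h => hU (Set.mem_iUnion.2 ⟨i, h⟩)
      · simp only [Set.indicator_of_notMem h, tsum_zero]
    have heq' : jumpCount X b j k (⋃ i, f i) = fun ω => ∑' i, jumpCount X b j k (f i) ω := funext heq
    refine ⟨heq' ▸ Measurable.tsum fun i => (hC i).1, ?_⟩
    rw [heq', lintegral_tsum fun i => (hC i).1.aemeasurable,
      lintegral_iUnion (fun i => hle _ (hfm i)) hdisj]
    exact tsum_congr fun i => (hC i).2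

end IsMarkovChain

end

end MarkovBSDE

/-! ### Vanishing intensities, absence of fixed jump times, and the kernel of the seminorm. -/

namespace MarkovBSDE

noncomputable section

theorem measurable_fst_predictable {Ω : Type*} {mΩ : MeasurableSpace Ω} (ℱ : Filtration ℝ≥0 mΩ) :
    Measurable[ℱ.predictable] (Prod.fst : ℝ≥0 × Ω → ℝ≥0) := by
  let := ℱ.predictable
  refine measurable_of_Ioi fun a => ?_
  have : (Prod.fst : ℝ≥0 × Ω → ℝ≥0) ⁻¹' Set.Ioi a = Set.Ioi a ×ˢ Set.univ := by
    ext; simp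
  rw [this]
  exact measurableSet_predictable_Ioi_prod (@MeasurableSet.univ _ (ℱ a))

variable {N : ℕ} {Ω : Type*} [mΩ : MeasurableSpace Ω] {P : Measure Ω}
  {X : ℝ≥0 → Ω → Fin N → ℝ} {A : ℝ≥0 → Matrix (Fin N) (Fin N) ℝ}

omit mΩ in
theorem jumpCount_eq_zero_iff (hX : ∀ ω, IsStepPath (X · ω)) {b : ℝ≥0} {j k : Fin N} (hjk : j ≠ k)
    {D : Set (ℝ≥0 × Ω)} {ω : Ω} : jumpCount X b j k D ω = 0 ↔
      ∀ s, 0 < s → s ≤ b → pre (X · ω) s = e j → X s ω = e k → (s, ω) ∉ D := by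
  rw [jumpCount, Finset.sum_eq_zero_iff]
  constructor
  · intro h s h0 hb hj hk hD
    have hmem : s ∈ jumpTimes (X · ω) b := by
      rw [(hX ω).mem_jumpTimes]
      refine ⟨⟨h0, hb⟩, ?_⟩
      rw [hj, hk]
      exact e_injective.ne hjk
    have := h s hmem
    rw [Set.indicator_of_mem (show (s, ω) ∈ {p : ℝ≥0 × Ω | pre (X · p.2) p.1 = e j ∧
      X p.1 p.2 = e k} from ⟨hj, hk⟩), Set.indicator_of_mem hD] at this
    exact one_ne_zero this
  · intro h s hs
    rw [(hX ω).mem_jumpTimes] at hs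
    refine Set.indicator_apply_eq_zero.2 fun hp => Set.indicator_of_notMem ?_ _
    exact h s hs.1.1 hs.1.2 hp.1 hp.2

namespace IsMarkovChain

variable [IsProbabilityMeasure P] (hX : IsMarkovChain P X A)
include hX

/-- If the chain almost surely does not jump from `e j` to `e k` at times in a predictable set,
then the intensity of these jumps vanishes almost everywhere on this set. -/
theorem ae_jumpRate_eq_zero {j k : Fin N} (hjk : j ≠ k) {D : Set (ℝ≥0 × Ω)}
    (hD : MeasurableSet[(chainFiltration P X hX.measurable).predictable] D)
    (h : ∀ᵐ ω ∂P, ∀ s, 0 < s → pre (X · ω) s = e j → X s ω = e k → (s, ω) ∉ D) :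
    ∀ᵐ p ∂(leb.prod P), p ∈ D → 0 < p.1 → jumpRate A X j k p = 0 := by
  have hD' := predictable_le _ _ hD
  -- On a bounded horizon the expected count is zero, so the integral of the nonnegative intensity
  -- over `D` is zero.
  have hb : ∀ n : ℕ, ∀ᵐ p ∂(leb.prod P), p ∈ D → 0 < p.1 → p.1 ≤ n → jumpRate A X j k p = 0 := by
    intro n
    have h1 := (hX.jumpCount_compensator n hjk hD).2
    have h2 : ∫⁻ ω, jumpCount X n j k D ω ∂P = 0 := by
      rw [lintegral_eq_zero_iff (hX.jumpCount_compensator n hjk hD).1]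
      filter_upwards [h] with ω hω
      exact (jumpCount_eq_zero_iff hX.isStepPath hjk).2 fun s h0 _ => hω s h0
    rw [h2, eq_comm, lintegral_eq_zero_iff (hX.measurable_jumpRate j k).ennreal_ofReal,
      EventuallyEq, ae_restrict_iff' hD'] at h1
    have h3 : (leb.restrict (Set.Ioc 0 (n : ℝ≥0))).prod P =
        (leb.prod P).restrict (Set.Ioc 0 (n : ℝ≥0) ×ˢ Set.univ) := by
      rw [← Measure.prod_restrict, Measure.restrict_univ]
    rw [h3, ae_restrict_iff' (measurableSet_Ioc.prod MeasurableSet.univ)] at h1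
    filter_upwards [h1] with p hp hpD h0 hn
    exact le_antisymm (ENNReal.ofReal_eq_zero.1 (hp ⟨⟨h0, hn⟩, trivial⟩ hpD))
      (hX.jumpRate_nonneg hjk p)
  filter_upwards [ae_all_iff.2 hb] with p hp hpD h0
  obtain ⟨n, hn⟩ := exists_nat_ge p.1
  exact hp n hpD h0 hn

/-- The chain has no fixed times of discontinuity. -/
theorem ae_pre_eq_of_pos {t : ℝ≥0} (ht : 0 < t) : ∀ᵐ ω ∂P, pre (X · ω) t = X t ω := by
  -- `{t} × Ω` is predictable and `dt × dP`-null, so the expected number of jumps at time `t` is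
  -- zero.
  have hD : MeasurableSet[(chainFiltration P X hX.measurable).predictable]
      ((Prod.fst : ℝ≥0 × Ω → ℝ≥0) ⁻¹' {t}) :=
    measurable_fst_predictable _ (measurableSet_singleton t)
  have h : ∀ j k : Fin N, j ≠ k → ∀ᵐ ω ∂P, ¬ (pre (X · ω) t = e j ∧ X t ω = e k) := by
    intro j k hjk
    obtain ⟨h1, h2⟩ := hX.jumpCount_compensator t hjk hD
    have h3 : ((leb.restrict (Set.Ioc 0 t)).prod P) ((Prod.fst : ℝ≥0 × Ω → ℝ≥0) ⁻¹' {t}) = 0 := by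
      have : (Prod.fst : ℝ≥0 × Ω → ℝ≥0) ⁻¹' {t} = {t} ×ˢ Set.univ := by ext; simp
      rw [this, Measure.prod_prod]
      simp
    rw [setLIntegral_measure_zero _ _ h3, lintegral_eq_zero_iff h1] at h2
    filter_upwards [h2] with ω hω hjk'
    exact (jumpCount_eq_zero_iff hX.isStepPath hjk).1 hω t ht le_rfl hjk'.1 hjk'.2 rfl
  have h' : ∀ᵐ ω ∂P, ∀ j k : Fin N, j ≠ k → ¬ (pre (X · ω) t = e j ∧ X t ω = e k) := by
    rw [ae_all_iff]; intro j
    rw [ae_all_iff]; intro k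
    by_cases hjk : j = k
    · simp [hjk]
    · filter_upwards [h j k hjk] with ω hω _ using hω
  filter_upwards [h'] with ω hω
  obtain ⟨j, hj⟩ := (hX.isStepPath ω).pre_mem_states t
  obtain ⟨k, hk⟩ := hX.mem_states t ω
  by_cases hjk : j = k
  · rw [hj, hk, hjk]
  · exact absurd ⟨hj, hk⟩ (hω j k hjk)

theorem ae_prod_pre_eq : ∀ᵐ p : ℝ≥0 × Ω ∂(leb.prod P), pre (X · p.2) p.1 = X p.1 p.2 := by
  have hm : MeasurableSet {p : ℝ≥0 × Ω | pre (X · p.2) p.1 = X p.1 p.2} :=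
    measurableSet_eq_fun hX.measurable_pre hX.measurable_uncurry
  rw [Measure.ae_prod_iff_ae_ae hm]
  have : ∀ᵐ t ∂leb, t ≠ 0 := by simp [ae_iff]
  filter_upwards [this] with t ht
  exact hX.ae_pre_eq_of_pos (pos_iff_ne_zero.2 ht)

end IsMarkovChain

/-- Stopping the time argument at `n` gives jointly measurable functions that are eventually equal
to `f` at each point. -/
theorem ProgDriver.measurable {ℱ : Filtration ℝ≥0 mΩ} {f : Ω → ℝ≥0 → ℝ → (Fin N → ℝ) → ℝ}
    (hf : ProgDriver ℱ f) :
    Measurable fun q : (ℝ≥0 × Ω) × (ℝ × (Fin N → ℝ)) => f q.1.2 q.1.1 q.2.1 q.2.2 := by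
  refine measurable_of_tendsto_metrizable
    (f := fun (n : ℕ) q => f q.1.2 (min q.1.1 n) q.2.1 q.2.2) (fun n => ?_) ?_
  · have h1 : Measurable fun p : (Set.Iic (n : ℝ≥0) × Ω) × (ℝ × (Fin N → ℝ)) =>
        f p.1.2 p.1.1 p.2.1 p.2.2 :=
      (hf n).mono (sup_le_sup_right (MeasurableSpace.comap_mono
        (sup_le_sup_left (MeasurableSpace.comap_mono (ℱ.le n)) _)) _) le_rfl
    have h2 : Measurable fun q : (ℝ≥0 × Ω) × (ℝ × (Fin N → ℝ)) =>
        (((⟨min q.1.1 n, Set.mem_Iic.2 (min_le_right _ _)⟩ : Set.Iic (n : ℝ≥0)), q.1.2), q.2) :=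
      ((Measurable.subtype_mk (by fun_prop)).prodMk (by fun_prop)).prodMk (by fun_prop)
    exact h1.comp h2
  · rw [tendsto_pi_nhds]
    intro q
    refine tendsto_nhds_of_eventually_eq ?_
    obtain ⟨m, hm⟩ := exists_nat_ge q.1.1
    filter_upwards [eventually_ge_atTop m] with n hn
    rw [min_eq_left (hm.trans (by exact_mod_cast hn))]

omit mΩ in
-- In state `e j` the quadratic form is `∑ k, A_kj (z_k - z_j)^2`. The proof shows directly that `Ψ
-- z = 0`: the first two terms of `Ψ z` cancel, and the third is a multiple of `∑ k, A_kj z_k = z_j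
-- ∑ k, A_kj = 0`.
theorem seminormSq_eq_zero {z : Fin N → ℝ} {t : ℝ≥0} {ω : Ω} {j : Fin N}
    (hA : ∑ i, A t i j = 0) (hj : pre (X · ω) t = e j)
    (h : ∀ k, k ≠ j → A t k j = 0 ∨ z k = z j) : seminormSq A X t ω z = 0 := by
  have h' : ∀ k, A t k j * z k = A t k j * z j := fun k => by
    by_cases hk : k = j
    · rw [hk]
    · rcases h k hk with h | h <;> rw [h]
      simp
  have h1 : ∑ k, A t k j * z k = 0 := by
    rw [Finset.sum_congr rfl fun k _ => h' k, ← Finset.sum_mul, hA, zero_mul]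
  have h2 : ∀ l, (Psi (A t) (e j) *ᵥ z) l = - (e j l * ∑ m, A t m j * z m) := by
    intro l
    rw [Psi, Matrix.sub_mulVec, Matrix.sub_mulVec, Pi.sub_apply, Pi.sub_apply,
      Matrix.mulVec_diagonal, mulVec_e, ← Matrix.mulVec_mulVec, ← Matrix.mulVec_mulVec,
      Matrix.mulVec_diagonal, h' l]
    have h3 : Matrix.diagonal (e j) *ᵥ z = z j • e j := by
      ext m
      rw [Matrix.mulVec_diagonal]
      by_cases hm : m = j <;> simp [e, hm]
    rw [h3, Matrix.mulVec_smul, Pi.smul_apply, mulVec_e, smul_eq_mul, mul_comm (z j), sub_self,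
      zero_sub]
    by_cases hl : l = j
    · rw [hl]; simp [Matrix.mulVec, dotProduct]
    · simp [e, hl]
  rw [seminormSq, hj]
  simp [dotProduct, h2, h1]

end

end MarkovBSDE

/-! ### Regularity of `u` read off from a single path. -/

namespace MarkovBSDE

noncomputable section

variable {N : ℕ}

/-- The time derivative of `u(·, e i)`. -/
def timeDeriv (u : ℝ≥0 → (Fin N → ℝ) → ℝ) (i : Fin N) (t : ℝ≥0) : ℝ :=
  deriv (fun r : ℝ => u r.toNNReal (e i)) t

theorem measurable_timeDeriv (u : ℝ≥0 → (Fin N → ℝ) → ℝ) (i : Fin N) :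
    Measurable (timeDeriv u i) :=
  (measurable_deriv _).comp measurable_coe_nnreal_real

/-- The increment of `u(·, e i)` from `a` to `b` is the integral of its derivative. -/
def IncrementEq (u : ℝ≥0 → (Fin N → ℝ) → ℝ) (i : Fin N) (a b : ℝ≥0) : Prop :=
  IntervalIntegrable (fun r : ℝ => timeDeriv u i r.toNNReal) volume a b ∧
    u b (e i) - u a (e i) = ∫ r in (a : ℝ)..b, timeDeriv u i r.toNNReal

theorem incrementEq_iff {u : ℝ≥0 → (Fin N → ℝ) → ℝ} {i : Fin N} {a b : ℝ≥0} (hab : a ≤ b) :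
    IncrementEq u i a b ↔ IntegrableOn (timeDeriv u i) (Set.Ioc a b) leb ∧
      u b (e i) - u a (e i) = ∫ s in Set.Ioc a b, timeDeriv u i s ∂leb := by
  rw [IncrementEq, integrableOn_leb_iff hab, setIntegral_leb hab]

theorem IncrementEq.symm {u : ℝ≥0 → (Fin N → ℝ) → ℝ} {i : Fin N} {a b : ℝ≥0}
    (h : IncrementEq u i a b) : IncrementEq u i b a :=
  ⟨h.1.symm, by rw [intervalIntegral.integral_symm, ← h.2]; ring⟩

theorem IncrementEq.trans {u : ℝ≥0 → (Fin N → ℝ) → ℝ} {i : Fin N} {a b c : ℝ≥0}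
    (h : IncrementEq u i a b) (h' : IncrementEq u i b c) : IncrementEq u i a c :=
  ⟨h.1.trans h'.1, by
    rw [← intervalIntegral.integral_add_adjacent_intervals h.1 h'.1, ← h.2, ← h'.2]; ring⟩

/-- The relation is symmetric and transitive in its end points, so on the connected interval `[s,
t]` its local validity suffices. Different points may use different paths, as `timeDeriv` does not
depend on the path. -/
theorem incrementEq_of_local {T : ℝ≥0∞} {u : ℝ≥0 → (Fin N → ℝ) → ℝ} {i : Fin N} {s t : ℝ≥0}
    (hst : s ≤ t) (ht : (t : ℝ≥0∞) ≤ T)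
    (h : ∀ r ∈ Set.Icc s t, ∀ᶠ y : ℝ≥0 in 𝓝 r, (y : ℝ≥0∞) ≤ T → IncrementEq u i r y) :
    IncrementEq u i s t := by
  refine (isPreconnected_Icc (a := s) (b := t)).induction₂' (IncrementEq u i) (fun r hr => ?_)
    (fun _ _ _ _ _ _ => IncrementEq.trans) (Set.left_mem_Icc.2 hst) (Set.right_mem_Icc.2 hst)
  filter_upwards [nhdsWithin_le_nhds (h r hr), self_mem_nhdsWithin] with y hy hy'
  have := hy (le_trans (by exact_mod_cast hy'.2) ht)
  exact ⟨this, this.symm⟩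

theorem continuousOn_of_incrementEq {T : ℝ≥0∞} {u : ℝ≥0 → (Fin N → ℝ) → ℝ} {i : Fin N}
    (h : ∀ s t : ℝ≥0, 0 < s → s ≤ t → (t : ℝ≥0∞) ≤ T → IncrementEq u i s t) :
    ContinuousOn (fun t => u t (e i)) {t : ℝ≥0 | 0 < t ∧ (t : ℝ≥0∞) ≤ T} := by
  rintro t ⟨h0, hT⟩
  obtain ⟨a, ha, hat⟩ := exists_between h0
  -- At `t = T` no time beyond `t` is available, and `b = t` serves because the neighbourhood is
  -- taken within times up to `T`.
  obtain ⟨b, htb, hbT, hb⟩ : ∃ b : ℝ≥0, t ≤ b ∧ (b : ℝ≥0∞) ≤ T ∧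
      ∀ᶠ s in 𝓝[{t : ℝ≥0 | 0 < t ∧ (t : ℝ≥0∞) ≤ T}] t, s ≤ b := by
    rcases hT.lt_or_eq with hT' | hT'
    · obtain ⟨b, hb1, hb2⟩ := ENNReal.lt_iff_exists_nnreal_btwn.1 hT'
      have hb1 : t < b := by exact_mod_cast hb1
      exact ⟨b, hb1.le, hb2.le, nhdsWithin_le_nhds (eventually_le_nhds hb1)⟩
    · refine ⟨t, le_rfl, hT, ?_⟩
      filter_upwards [self_mem_nhdsWithin] with s hs
      have := hs.2
      rw [← hT'] at this
      exact_mod_cast this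
  have hint := (h a b ha (hat.le.trans htb) hbT).1
  have hcont := intervalIntegral.continuousOn_primitive_interval'
    hint (Set.left_mem_uIcc (a := (a : ℝ)) (b := b))
  have hmem : ∀ᶠ s in 𝓝[{t : ℝ≥0 | 0 < t ∧ (t : ℝ≥0∞) ≤ T}] t, s ∈ Set.Icc a b := by
    filter_upwards [hb, nhdsWithin_le_nhds (eventually_ge_nhds hat)] with s h1 h2 using ⟨h2, h1⟩
  have hc : ContinuousWithinAt (fun s : ℝ≥0 => u a (e i) +
      ∫ r in (a : ℝ)..s, timeDeriv u i r.toNNReal) {t : ℝ≥0 | 0 < t ∧ (t : ℝ≥0∞) ≤ T} t := by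
    refine continuousWithinAt_const.add ?_
    have hmaps : Tendsto ((↑) : ℝ≥0 → ℝ) (𝓝[{t : ℝ≥0 | 0 < t ∧ (t : ℝ≥0∞) ≤ T}] t)
        (𝓝[Set.uIcc (a : ℝ) b] (t : ℝ)) := by
      refine tendsto_nhdsWithin_iff.2 ⟨NNReal.continuous_coe.continuousAt.tendsto.mono_left
        nhdsWithin_le_nhds, ?_⟩
      filter_upwards [hmem] with s hs
      rw [Set.uIcc_of_le (by exact_mod_cast hat.le.trans htb)]
      exact ⟨by exact_mod_cast hs.1, by exact_mod_cast hs.2⟩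
    refine Tendsto.comp (hcont (t : ℝ) ?_) hmaps
    rw [Set.uIcc_of_le (by exact_mod_cast hat.le.trans htb)]
    exact ⟨by exact_mod_cast hat.le, by exact_mod_cast htb⟩
  refine hc.congr_of_eventuallyEq ?_ ?_
  · filter_upwards [hmem] with s hs
    rw [← (h a s ha hs.1 (le_trans (by exact_mod_cast hs.2) hbT)).2]
    ring
  · rw [← (h a t ha hat.le hT).2]
    ring

/-- Along the step path `x`, the process `u(t, x_t)` has the drift `h` and the jumps
`z_s^* (x_s - x_{s-})` up to time `T`. -/
structure IsPathSolution (T : ℝ≥0∞) (u : ℝ≥0 → (Fin N → ℝ) → ℝ) (x z : ℝ≥0 → Fin N → ℝ)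
    (h : ℝ≥0 → ℝ) : Prop where
  step : IsStepPath x
  integrable : ∀ t : ℝ≥0, (t : ℝ≥0∞) ≤ T → IntegrableOn h (Set.Ioc 0 t) leb
  increment_zero : ∀ t : ℝ≥0, (t : ℝ≥0∞) ≤ T → u t (x t) =
    u 0 (x 0) + ∑ s ∈ jumpTimes x t, z s ⬝ᵥ (x s - pre x s) + ∫ s in Set.Ioc 0 t, h s ∂leb

namespace IsPathSolution

variable {T : ℝ≥0∞} {u : ℝ≥0 → (Fin N → ℝ) → ℝ} {x z : ℝ≥0 → Fin N → ℝ} {h : ℝ≥0 → ℝ}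
  (hs : IsPathSolution T u x z h)
include hs

theorem integrableOn {a b : ℝ≥0} (hb : (b : ℝ≥0∞) ≤ T) : IntegrableOn h (Set.Ioc a b) leb :=
  (hs.integrable b hb).mono_set (Set.Ioc_subset_Ioc_left zero_le)

theorem increment {a b : ℝ≥0} (hab : a ≤ b) (hb : (b : ℝ≥0∞) ≤ T) :
    u b (x b) - u a (x a) = ∑ s ∈ (jumpTimes x b).filter (a < ·), z s ⬝ᵥ (x s - pre x s) +
      ∫ s in Set.Ioc a b, h s ∂leb := by
  have ha : (a : ℝ≥0∞) ≤ T := le_trans (by exact_mod_cast hab) hb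
  rw [hs.increment_zero b hb, hs.increment_zero a ha,
    ← Set.Ioc_union_Ioc_eq_Ioc zero_le hab,
    setIntegral_union (Set.Ioc_disjoint_Ioc_of_le le_rfl) measurableSet_Ioc
      (hs.integrableOn ha) (hs.integrableOn hb),
    ← Finset.sum_filter_add_sum_filter_not (jumpTimes x b) (fun s => a < s),
    hs.step.jumpTimes_filter_le hab]
  ring

theorem increment_of_const {a b : ℝ≥0} (hab : a ≤ b) (hb : (b : ℝ≥0∞) ≤ T) {i : Fin N}
    (hi : ∀ s ∈ Set.Icc a b, x s = e i) :
    u b (e i) - u a (e i) = ∫ s in Set.Ioc a b, h s ∂leb := by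
  have h1 := hs.increment hab hb
  rw [hi a ⟨le_rfl, hab⟩, hi b ⟨hab, le_rfl⟩, Finset.sum_eq_zero, zero_add] at h1
  · exact h1
  · intro s hs'
    rw [Finset.mem_filter, hs.step.mem_jumpTimes] at hs'
    rw [hi s ⟨hs'.2.le, hs'.1.1.2⟩, hs.step.pre_eq_of_const
      (fun r h1 h2 => hi r ⟨h1, h2.le⟩) hs'.2 hs'.1.1.2]
    simp

/-- Without jumps `u(·, e i)` is a primitive of `h` on `[a, b]`; apply Lebesgue differentiation. -/
theorem ae_eq_timeDeriv_of_const {a b : ℝ≥0} (hb : (b : ℝ≥0∞) ≤ T) {i : Fin N}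
    (hi : ∀ s ∈ Set.Icc a b, x s = e i) :
    ∀ᵐ t ∂leb, t ∈ Set.Ioo a b → h t = timeDeriv u i t := by
  rcases le_or_gt b a with hab | hab
  · simp [Set.Ioo_eq_empty_of_le hab]
  have hint := (integrableOn_leb_iff hab.le).1 (hs.integrableOn hb (a := a))
  have hab' : (a : ℝ) ≤ b := by exact_mod_cast hab.le
  have h1 := ae_leb_of_ae hint.ae_hasDerivAt_integral
  filter_upwards [h1] with t ht hmem
  have h2 := ht (by rw [Set.uIcc_of_le hab']; exact ⟨by exact_mod_cast hmem.1.le,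
    by exact_mod_cast hmem.2.le⟩) a Set.left_mem_uIcc
  rw [Real.toNNReal_coe] at h2
  have h3 : (fun r : ℝ => u r.toNNReal (e i)) =ᶠ[𝓝 (t : ℝ)]
      fun r => u a (e i) + ∫ s in (a : ℝ)..r, h s.toNNReal := by
    filter_upwards [Ioo_mem_nhds (show (a : ℝ) < t by exact_mod_cast hmem.1)
      (show (t : ℝ) < b by exact_mod_cast hmem.2)] with r hr
    have hr0 : 0 ≤ r := a.2.trans hr.1.le
    lift r to ℝ≥0 using hr0
    have har : a ≤ r := by exact_mod_cast hr.1.le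
    have hrb : r ≤ b := by exact_mod_cast hr.2.le
    rw [Real.toNNReal_coe, ← setIntegral_leb har, ← hs.increment_of_const har
      (le_trans (by exact_mod_cast hrb) hb) fun s hs => hi s ⟨hs.1, hs.2.trans hrb⟩]
    ring
  exact ((h2.const_add (u a (e i))).congr_of_eventuallyEq h3).deriv.symm

theorem incrementEq_of_const {a b : ℝ≥0} (hab : a ≤ b) (hb : (b : ℝ≥0∞) ≤ T) {i : Fin N}
    (hi : ∀ s ∈ Set.Icc a b, x s = e i) : IncrementEq u i a b := by
  have hne : ∀ᵐ t ∂leb, t ≠ b := by simp [ae_iff]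
  have hae : ∀ᵐ t ∂leb, t ∈ Set.Ioc a b → h t = timeDeriv u i t := by
    filter_upwards [hs.ae_eq_timeDeriv_of_const hb hi, hne] with t h1 h2 h3
    exact h1 ⟨h3.1, lt_of_le_of_ne h3.2 h2⟩
  rw [incrementEq_iff hab, ← setIntegral_congr_ae measurableSet_Ioc hae]
  exact ⟨(hs.integrableOn hb).congr ((ae_restrict_iff' measurableSet_Ioc).2 hae),
    hs.increment_of_const hab hb hi⟩

theorem eventually_incrementEq {t : ℝ≥0} (ht : (t : ℝ≥0∞) ≤ T) {i : Fin N}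
    (hi : ∀ᶠ s in 𝓝 t, x s = e i) :
    ∀ᶠ s : ℝ≥0 in 𝓝 t, (s : ℝ≥0∞) ≤ T → IncrementEq u i t s := by
  have h1 : ∀ᶠ s in 𝓝 t, ∀ r ∈ Set.uIcc t s, x r = e i :=
    (tendsto_const_nhds.uIcc tendsto_id).eventually hi.smallSets
  filter_upwards [h1] with s h2 hsT
  rcases le_total t s with hts | hts
  · exact hs.incrementEq_of_const hts hsT fun r hr => h2 r (Set.uIcc_of_le hts ▸ hr)
  · exact (hs.incrementEq_of_const hts ht fun r hr => h2 r (Set.uIcc_of_ge hts ▸ hr)).symm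

/-- Apart from jump times and the end points `0` and `T`, every time spent in `e i` has an open
neighbourhood on which the path is constant. The exceptional set is locally null, hence null. -/
theorem ae_eq_timeDeriv (i : Fin N) :
    ∀ᵐ t : ℝ≥0 ∂leb, (t : ℝ≥0∞) ≤ T → x t = e i → h t = timeDeriv u i t := by
  have hnull : leb {t : ℝ≥0 | 0 < t ∧ (t : ℝ≥0∞) < T ∧ pre x t = e i ∧ x t = e i ∧
      ¬ h t = timeDeriv u i t} = 0 := by
    refine measure_null_of_locally_null _ fun t ht => ?_
    obtain ⟨h0, hT, hp, hx, -⟩ := ht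
    obtain ⟨a, ha, ha'⟩ := hs.step.exists_left h0
    obtain ⟨b₀, hb₀, hb₀'⟩ := hs.step.exists_right t
    obtain ⟨b₁, hb₁, hb₁'⟩ := ENNReal.lt_iff_exists_nnreal_btwn.1 hT
    have hb₁ : t < b₁ := by exact_mod_cast hb₁
    obtain ⟨b, hb, hb'⟩ := exists_between (lt_min hb₀ hb₁)
    have hbT : (b : ℝ≥0∞) ≤ T :=
      le_trans (by exact_mod_cast (hb'.trans_le (min_le_right _ _)).le) hb₁'.le
    have hconst : ∀ s ∈ Set.Icc a b, x s = e i := fun s hs' => by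
      rcases lt_or_ge s t with hst | hst
      · rw [ha' s hs'.1 hst, hp]
      · rw [hb₀' s hst (hs'.2.trans_lt (hb'.trans_le (min_le_left _ _))), hx]
    refine ⟨_, inter_mem self_mem_nhdsWithin (mem_nhdsWithin_of_mem_nhds (Ioo_mem_nhds ha hb)), ?_⟩
    refine measure_mono_null ?_ (ae_iff.1 (hs.ae_eq_timeDeriv_of_const hbT hconst))
    rintro s ⟨h1, h2⟩ h3
    exact h1.2.2.2.2 (h3 h2)
  have hne0 : ∀ᵐ t ∂leb, t ≠ 0 := by simp [ae_iff]
  have hneT : ∀ᵐ t ∂leb, t ≠ T.toNNReal := by simp [ae_iff]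
  have hnull' : ∀ᵐ t : ℝ≥0 ∂leb, ¬ (0 < t ∧ (t : ℝ≥0∞) < T ∧ pre x t = e i ∧ x t = e i ∧
      ¬ h t = timeDeriv u i t) := by
    rw [ae_iff]
    simpa only [not_not] using hnull
  filter_upwards [hnull', hne0, hneT, hs.step.ae_pre_eq] with t h1 h2 h3 h4 hT hx
  by_contra hcon
  refine h1 ⟨pos_iff_ne_zero.2 h2, lt_of_le_of_ne hT fun h => h3 ?_, h4.trans hx, hx, hcon⟩
  rw [← h, ENNReal.toNNReal_coe]

/-- Choose `a < t` so that `t` is the only jump in `]a, t]`. The drift over `]a, t]` integrates to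
`u(t, e j) - u(a, e j)`; what remains of the increment of `u(s, x_s)` is the jump. -/
theorem jump_eq {j k : Fin N} (hj : ∀ s t : ℝ≥0, 0 < s → s ≤ t → (t : ℝ≥0∞) ≤ T →
    IncrementEq u j s t) {t : ℝ≥0} (h0 : 0 < t) (hT : (t : ℝ≥0∞) ≤ T) (hjk : j ≠ k)
    (hp : pre x t = e j) (hx : x t = e k) :
    z t k - z t j = u t (e k) - u t (e j) := by
  obtain ⟨a₀, ha₀, ha₀'⟩ := hs.step.exists_left h0
  obtain ⟨a, ha, hat⟩ := exists_between ha₀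
  have ha0 : 0 < a := bot_lt_of_lt ha
  have h1 := hs.increment hat.le hT
  have h2 : (jumpTimes x t).filter (a < ·) = {t} := by
    ext s
    rw [Finset.mem_filter, hs.step.mem_jumpTimes, Finset.mem_singleton]
    constructor
    · rintro ⟨⟨⟨-, h3⟩, h4⟩, h5⟩
      by_contra hne
      have hst := lt_of_le_of_ne h3 hne
      exact h4 ((hs.step.pre_eq_of_const ha₀' (ha.trans h5) h3).trans
        (ha₀' s (ha.trans h5).le hst).symm)
    · rintro rfl
      exact ⟨⟨⟨h0, le_rfl⟩, by rw [hp, hx]; exact e_injective.ne hjk⟩, hat⟩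
  have hne : ∀ᵐ s ∂leb, s ≠ t := by simp [ae_iff]
  have h3 : ∀ᵐ s ∂leb, s ∈ Set.Ioc a t → h s = timeDeriv u j s := by
    filter_upwards [hs.ae_eq_timeDeriv j, hne] with s h1 h2 h3
    refine h1 (le_trans (by exact_mod_cast h3.2) hT) ?_
    rw [ha₀' s (ha.le.trans h3.1.le) (lt_of_le_of_ne h3.2 h2), hp]
  rw [h2, Finset.sum_singleton, setIntegral_congr_ae measurableSet_Ioc h3,
    ← ((incrementEq_iff hat.le).1 (hj a t ha0 hat.le hT)).2, hx, hp, ha₀' a ha.le hat, hp,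
    dotProduct_sub] at h1
  simp only [e, dotProduct_single, mul_one] at h1
  simp only [e]
  linarith

theorem pre_process_eq {y : ℝ≥0 → ℝ} (hy : ∀ t : ℝ≥0, (t : ℝ≥0∞) ≤ T → y t = u t (x t))
    {i : Fin N} (hi : ContinuousOn (fun t => u t (e i)) {t : ℝ≥0 | 0 < t ∧ (t : ℝ≥0∞) ≤ T})
    {t : ℝ≥0} (h0 : 0 < t) (hT : (t : ℝ≥0∞) ≤ T) (hp : pre x t = e i) :
    pre y t = u t (e i) := by
  have : (𝓝[<] t).NeBot := nhdsLT_neBot_of_exists_lt ⟨0, h0⟩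
  refine leftLim_eq_of_tendsto ?_
  have h1 : ∀ᶠ s in 𝓝[<] t, s ∈ {t : ℝ≥0 | 0 < t ∧ (t : ℝ≥0∞) ≤ T} := by
    filter_upwards [self_mem_nhdsWithin, nhdsWithin_le_nhds (eventually_gt_nhds h0)] with s hs1 hs2
    exact ⟨hs2, le_trans (by exact_mod_cast (Set.mem_Iio.1 hs1).le) hT⟩
  have h2 : Tendsto (fun s => u s (e i)) (𝓝[<] t) (𝓝 (u t (e i))) :=
    (hi t ⟨h0, hT⟩).tendsto.comp (tendsto_nhdsWithin_iff.2 ⟨tendsto_id.mono_left nhdsWithin_le_nhds, h1⟩)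
  refine h2.congr' ?_
  filter_upwards [h1, hs.step.eventually_left t] with s hs1 hs2
  rw [hy s hs1.2, hs2, hp]

end IsPathSolution

end

end MarkovBSDE

/-! ### From paths to `dt × dP`: the equivalence of `Z` and `𝐮`, the driver, and the equation. -/

namespace MarkovBSDE

noncomputable section

theorem IsStepPath.finsum_jumps {N : ℕ} {x : ℝ≥0 → Fin N → ℝ} (hx : IsStepPath x)
    (z : ℝ≥0 → Fin N → ℝ) (t : ℝ≥0) :
    ∑ᶠ s ∈ Set.Ioc 0 t, z s ⬝ᵥ (x s - pre x s) =
      ∑ s ∈ jumpTimes x t, z s ⬝ᵥ (x s - pre x s) := by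
  refine finsum_mem_eq_sum_of_inter_support_eq _ ?_
  ext s
  simp only [Set.mem_inter_iff, Set.mem_Ioc, mem_support, Finset.mem_coe, hx.mem_jumpTimes]
  refine and_congr_left fun hs => ⟨fun h => ⟨h, fun h' => hs ?_⟩, fun h => h.1⟩
  rw [h', sub_self, dotProduct_zero]

theorem IsStepPath.eventually_eq {N : ℕ} {x : ℝ≥0 → Fin N → ℝ} (hx : IsStepPath x) {t : ℝ≥0}
    (h : pre x t = x t) : ∀ᶠ s in 𝓝 t, x s = x t := by
  rw [← nhdsLT_sup_nhdsGE, eventually_sup]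
  exact ⟨h ▸ hx.eventually_left t, hx.eventually_right t⟩

variable {N : ℕ} {Ω : Type*} [mΩ : MeasurableSpace Ω] {P : Measure Ω}
  {X : ℝ≥0 → Ω → Fin N → ℝ} {A : ℝ≥0 → Matrix (Fin N) (Fin N) ℝ} {T : ℝ≥0∞}
  {f : Ω → ℝ≥0 → ℝ → (Fin N → ℝ) → ℝ} {Y : ℝ≥0 → Ω → ℝ} {Z : ℝ≥0 → Ω → Fin N → ℝ}
  {u : ℝ≥0 → (Fin N → ℝ) → ℝ} {ℱ : Filtration ℝ≥0 mΩ}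

theorem IsSolution.ae_isPathSolution (hX : ∀ ω, IsStepPath (X · ω))
    (hYZ : IsSolution P X A ℱ T f Y Z) (hu : IsMarkovianWith P X T Y u) :
    ∀ᵐ ω ∂P, IsPathSolution T u (X · ω) (Z · ω)
      (fun s => -(f ω s (pre (Y · ω) s) (Z s ω) + Z s ω ⬝ᵥ (A s *ᵥ pre (X · ω) s))) := by
  filter_upwards [hYZ.integrable_driver, hYZ.integrable_comp, hYZ.dynamics, hu] with ω h1 h2 h3 h4
  refine ⟨hX ω, fun t ht => ((h1 t ht).add (h2 t ht)).neg, fun t ht => ?_⟩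
  have h5 := h3 t ht
  rw [h4 t ht, h4 0 (by simp), stochInt, (hX ω).finsum_jumps (Z · ω)] at h5
  rw [h5, integral_neg, integral_add (h1 t ht) (h2 t ht)]
  ring

/-- A measurable version of `u(·, e i)`. -/
def uState (T : ℝ≥0∞) (u : ℝ≥0 → (Fin N → ℝ) → ℝ) (i : Fin N) (t : ℝ≥0) : ℝ :=
  Set.indicator {t : ℝ≥0 | 0 < t ∧ (t : ℝ≥0∞) ≤ T} (fun t => u t (e i)) t

theorem measurableSet_timeInterval (T : ℝ≥0∞) :
    MeasurableSet {t : ℝ≥0 | 0 < t ∧ (t : ℝ≥0∞) ≤ T} :=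
  (measurableSet_lt measurable_const measurable_id).inter
    (measurableSet_le measurable_coe_nnreal_ennreal measurable_const)

theorem uState_eq {t : ℝ≥0} (h0 : 0 < t) (hT : (t : ℝ≥0∞) ≤ T) (i : Fin N) :
    uState T u i t = u t (e i) :=
  Set.indicator_of_mem (show t ∈ {t : ℝ≥0 | 0 < t ∧ (t : ℝ≥0∞) ≤ T} from ⟨h0, hT⟩) _

theorem measurable_uState {i : Fin N}
    (hi : ContinuousOn (fun t => u t (e i)) {t : ℝ≥0 | 0 < t ∧ (t : ℝ≥0∞) ≤ T}) :
    Measurable (uState T u i) := by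
  classical
  have : uState T u i = Set.piecewise {t : ℝ≥0 | 0 < t ∧ (t : ℝ≥0∞) ≤ T}
      (fun t => u t (e i)) (fun _ => 0) := by
    ext t; rw [uState, Set.indicator_apply, Set.piecewise]
  rw [this]
  exact hi.measurable_piecewise continuousOn_const (measurableSet_timeInterval T)

/-- The process equal to `𝐮_t` for `0 < t ≤ T`, and to `Z_t` at other times. -/
def uExtension (T : ℝ≥0∞) (u : ℝ≥0 → (Fin N → ℝ) → ℝ) (Z : ℝ≥0 → Ω → Fin N → ℝ) (t : ℝ≥0) (ω : Ω) :
    Fin N → ℝ := by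
  classical
  exact if 0 < t ∧ (t : ℝ≥0∞) ≤ T then uVec u t else Z t ω

/-- The part on `]0, T]` is deterministic and measurable in time. Elsewhere nothing is known about
`u`; keeping `Z` there makes predictability and equivalence with `Z` automatic. -/
theorem isStronglyPredictable_uExtension (hZ : IsStronglyPredictable ℱ Z)
    (hu : ∀ i : Fin N, ContinuousOn (fun t => u t (e i)) {t : ℝ≥0 | 0 < t ∧ (t : ℝ≥0∞) ≤ T}) :
    IsStronglyPredictable ℱ (uExtension T u Z) := by
  classical
  let := ℱ.predictable
  have hfst : Measurable (Prod.fst : ℝ≥0 × Ω → ℝ≥0) := measurable_fst_predictable ℱ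
  have heq : uncurry (uExtension T u Z) = fun p : ℝ≥0 × Ω =>
      if p ∈ (Prod.fst : ℝ≥0 × Ω → ℝ≥0) ⁻¹' {t : ℝ≥0 | 0 < t ∧ (t : ℝ≥0∞) ≤ T} then
        (fun i => uState T u i p.1) else uncurry Z p := by
    ext p i
    simp only [uncurry, uExtension, Set.mem_preimage, Set.mem_ofPred_eq]
    split_ifs with h
    · exact (uState_eq h.1 h.2 i).symm
    · rfl
  have hm : Measurable (uncurry (uExtension T u Z)) := by
    rw [heq]
    refine Measurable.ite (hfst (measurableSet_timeInterval T)) ?_ hZ.measurable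
    exact measurable_pi_lambda _ fun i => (measurable_uState (hu i)).comp hfst
  exact hm.stronglyMeasurable

variable [IsProbabilityMeasure P] (hX : IsMarkovChain P X A)
  (hpos : ∀ t : ℝ≥0, 0 < t → ∀ i : Fin N, 0 < P {ω | X t ω = e i})
  (hYZ : IsSolution P X A (chainFiltration P X hX.measurable) T f Y Z)
  (hu : IsMarkovianWith P X T Y u)

namespace IsSolution

include hpos hYZ hu in
-- Positivity of `P(X_r = e_i)` gives, for each `r`, a path that solves the equation, is in `e i` at
-- time `r` and does not jump there, hence stays in `e i` around `r`.
theorem incrementEq (i : Fin N) {s t : ℝ≥0} (hs : 0 < s) (hst : s ≤ t) (ht : (t : ℝ≥0∞) ≤ T) :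
    IncrementEq u i s t := by
  refine incrementEq_of_local hst ht fun r hr => ?_
  obtain ⟨ω, h1, h2, h3⟩ := ((frequently_ae_iff.2 (hpos r (hs.trans_le hr.1) i).ne').and_eventually
    ((hX.ae_pre_eq_of_pos (hs.trans_le hr.1)).and
      (hYZ.ae_isPathSolution hX.isStepPath hu))).exists
  refine h3.eventually_incrementEq (le_trans (by exact_mod_cast hr.2) ht) ?_
  have := h3.step.eventually_eq h2
  rwa [h1] at this

include hpos hYZ hu in
theorem incrementEq_zero {i : Fin N} (hi : ∀ ω, X 0 ω = e i) {t : ℝ≥0} (ht : (t : ℝ≥0∞) ≤ T) :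
    IncrementEq u i 0 t := by
  refine incrementEq_of_local zero_le ht fun r hr => ?_
  have hrT : (r : ℝ≥0∞) ≤ T := le_trans (by exact_mod_cast hr.2) ht
  rcases eq_zero_or_pos r with rfl | h0
  -- At time `0` every path is in `e i`, and `x_{0-} = x_0` excludes a jump; any good path will do.
  · obtain ⟨ω, h3⟩ := (hYZ.ae_isPathSolution hX.isStepPath hu).exists
    refine h3.eventually_incrementEq hrT ?_
    have := h3.step.eventually_eq IsStepPath.pre_zero
    rwa [hi] at this
  · obtain ⟨ω, h1, h2, h3⟩ := ((frequently_ae_iff.2 (hpos r h0 i).ne').and_eventually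
      ((hX.ae_pre_eq_of_pos h0).and (hYZ.ae_isPathSolution hX.isStepPath hu))).exists
    refine h3.eventually_incrementEq hrT ?_
    have := h3.step.eventually_eq h2
    rwa [h1] at this

include hpos hYZ hu in
theorem continuousOn (i : Fin N) :
    ContinuousOn (fun t => u t (e i)) {t : ℝ≥0 | 0 < t ∧ (t : ℝ≥0∞) ≤ T} :=
  continuousOn_of_incrementEq fun _ _ => hYZ.incrementEq hX hpos hu i

include hpos hYZ hu in
/-- Wherever a jump from the current state `e j` to `e k` has positive intensity, the increment
`Z_k - Z_j` is the increment of `𝐮`. -/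
theorem ae_increment_eq : ∀ᵐ p : ℝ≥0 × Ω ∂(leb.prod P), 0 < p.1 → (p.1 : ℝ≥0∞) ≤ T →
    ∀ j k : Fin N, j ≠ k → pre (X · p.2) p.1 = e j → A p.1 k j = 0 ∨
      Z p.1 p.2 k - Z p.1 p.2 j = u p.1 (e k) - u p.1 (e j) := by
  have key : ∀ j k : Fin N, j ≠ k → ∀ᵐ p : ℝ≥0 × Ω ∂(leb.prod P), 0 < p.1 → (p.1 : ℝ≥0∞) ≤ T →
      pre (X · p.2) p.1 = e j → A p.1 k j = 0 ∨
      Z p.1 p.2 k - Z p.1 p.2 j = u p.1 (e k) - u p.1 (e j) := by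
    intro j k hjk
    -- The set where the increments disagree is predictable, and by `jump_eq` almost surely no jump
    -- from `e j` to `e k` occurs in it.
    have hD : MeasurableSet[(chainFiltration P X hX.measurable).predictable]
        ({p : ℝ≥0 × Ω | Z p.1 p.2 k - Z p.1 p.2 j = uState T u k p.1 - uState T u j p.1}ᶜ ∩
          Prod.fst ⁻¹' {t : ℝ≥0 | 0 < t ∧ (t : ℝ≥0∞) ≤ T}) := by
      let := (chainFiltration P X hX.measurable).predictable
      have hfst : Measurable (Prod.fst : ℝ≥0 × Ω → ℝ≥0) :=
        measurable_fst_predictable (chainFiltration P X hX.measurable)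
      have hZ : Measurable (uncurry Z) := hYZ.predictable.measurable
      refine (MeasurableSet.compl (measurableSet_eq_fun ?_ ?_)).inter
        (hfst (measurableSet_timeInterval T))
      · exact ((measurable_pi_apply k).comp hZ).sub ((measurable_pi_apply j).comp hZ)
      · exact ((measurable_uState (hYZ.continuousOn hX hpos hu k)).comp hfst).sub
          ((measurable_uState (hYZ.continuousOn hX hpos hu j)).comp hfst)
    have h1 := hX.ae_jumpRate_eq_zero hjk hD (by
      filter_upwards [hYZ.ae_isPathSolution hX.isStepPath hu] with ω hω s h0 hp hx hmem
      obtain ⟨hne, -, hT⟩ := hmem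
      refine hne ?_
      change Z s ω k - Z s ω j = uState T u k s - uState T u j s
      rw [uState_eq h0 hT, uState_eq h0 hT]
      exact hω.jump_eq (fun _ _ => hYZ.incrementEq hX hpos hu j) h0 hT hjk hp hx)
    filter_upwards [h1] with p hp h0 hT hj
    by_cases hne : Z p.1 p.2 k - Z p.1 p.2 j = u p.1 (e k) - u p.1 (e j)
    · exact Or.inr hne
    · left
      have h2 := hp ⟨fun h => hne ?_, h0, hT⟩ h0
      · rwa [jumpRate, Set.indicator_of_mem (show p ∈ {p : ℝ≥0 × Ω | pre (X · p.2) p.1 = e j}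
          from hj)] at h2
      · have h : Z p.1 p.2 k - Z p.1 p.2 j = uState T u k p.1 - uState T u j p.1 := h
        rwa [uState_eq h0 hT, uState_eq h0 hT] at h
  have key' : ∀ᵐ p : ℝ≥0 × Ω ∂(leb.prod P), ∀ j k : Fin N, j ≠ k → 0 < p.1 →
      (p.1 : ℝ≥0∞) ≤ T → pre (X · p.2) p.1 = e j → A p.1 k j = 0 ∨
      Z p.1 p.2 k - Z p.1 p.2 j = u p.1 (e k) - u p.1 (e j) := by
    rw [ae_all_iff]; intro j
    rw [ae_all_iff]; intro k
    by_cases hjk : j = k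
    · simp [hjk]
    · filter_upwards [key j k hjk] with p hp _ using hp
  filter_upwards [key'] with p hp h0 hT j k hjk hj using hp j k hjk h0 hT hj

include hpos hYZ hu in
theorem equivM_uExtension : EquivM P X A Z (uExtension T u Z) := by
  filter_upwards [hYZ.ae_increment_eq hX hpos hu] with p hp
  obtain ⟨j, hj⟩ := (hX.isStepPath p.2).pre_mem_states p.1
  refine seminormSq_eq_zero (hX.rate.col_sum p.1 j) hj fun k hk => ?_
  by_cases h : 0 < p.1 ∧ (p.1 : ℝ≥0∞) ≤ T
  · refine (hp h.1 h.2 j k hk.symm hj).imp_right fun h1 => ?_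
    simp only [uExtension, if_pos h, Pi.sub_apply, uVec]
    linarith
  · right
    simp [uExtension, if_neg h]

include hpos hYZ hu in
-- The identity is known for almost every `ω` at almost every `t`. Passing to the product measure
-- requires a measurable set, hence `uState` in place of `u` in the proof.
theorem ae_driver_add (hf : ProgDriver (chainFiltration P X hX.measurable) f) :
    ∀ᵐ p : ℝ≥0 × Ω ∂(leb.prod P), 0 < p.1 → (p.1 : ℝ≥0∞) ≤ T → ∀ i : Fin N, X p.1 p.2 = e i →
      f p.2 p.1 (u p.1 (e i)) (Z p.1 p.2) + Z p.1 p.2 ⬝ᵥ (A p.1 *ᵥ e i) =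
        -timeDeriv u i p.1 := by
  have hZ : Measurable (uncurry Z) :=
    hYZ.predictable.measurable.mono (predictable_le _) le_rfl
  have key : ∀ᵐ p : ℝ≥0 × Ω ∂(leb.prod P), ∀ i : Fin N,
      p.1 ∈ {t : ℝ≥0 | 0 < t ∧ (t : ℝ≥0∞) ≤ T} → X p.1 p.2 = e i →
      f p.2 p.1 (uState T u i p.1) (Z p.1 p.2) + Z p.1 p.2 ⬝ᵥ (A p.1 *ᵥ e i) =
        -timeDeriv u i p.1 := by
    rw [ae_all_iff]
    intro i
    have hm : MeasurableSet {p : ℝ≥0 × Ω | p.1 ∈ {t : ℝ≥0 | 0 < t ∧ (t : ℝ≥0∞) ≤ T} →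
        X p.1 p.2 = e i → f p.2 p.1 (uState T u i p.1) (Z p.1 p.2) +
          Z p.1 p.2 ⬝ᵥ (A p.1 *ᵥ e i) = -timeDeriv u i p.1} := by
      refine MeasurableSet.imp (measurable_fst (measurableSet_timeInterval T))
        (MeasurableSet.imp (hX.measurable_uncurry (measurableSet_singleton _))
        (measurableSet_eq_fun (Measurable.add ?_ ?_)
          ((measurable_timeDeriv u i).comp measurable_fst).neg))
      · exact hf.measurable.comp (measurable_id.prodMk
          (((measurable_uState (hYZ.continuousOn hX hpos hu i)).comp measurable_fst).prodMk hZ))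
      · simp only [dotProduct, mulVec_e]
        exact Finset.measurable_fun_sum _ fun k _ => ((measurable_pi_apply k).comp hZ).mul
          ((hX.rate.measurable k i).comp measurable_fst)
    have hswap : ∀ᵐ ω ∂P, ∀ᵐ t ∂leb, t ∈ {t : ℝ≥0 | 0 < t ∧ (t : ℝ≥0∞) ≤ T} →
        X t ω = e i → f ω t (uState T u i t) (Z t ω) +
          Z t ω ⬝ᵥ (A t *ᵥ e i) = -timeDeriv u i t := by
      filter_upwards [hYZ.ae_isPathSolution hX.isStepPath hu, hu] with ω h1 h2
      filter_upwards [h1.ae_eq_timeDeriv i, h1.step.ae_pre_eq] with t h3 h4 ht hx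
      rw [hx] at h4
      rw [← h3 ht.2 hx, neg_neg, h4,
        h1.pre_process_eq h2 (hYZ.continuousOn hX hpos hu i) ht.1 ht.2 h4, uState_eq ht.1 ht.2]
    have h5 : ∀ᵐ q : Ω × ℝ≥0 ∂(P.prod leb), q.swap ∈ {p : ℝ≥0 × Ω |
        p.1 ∈ {t : ℝ≥0 | 0 < t ∧ (t : ℝ≥0∞) ≤ T} →
        X p.1 p.2 = e i → f p.2 p.1 (uState T u i p.1) (Z p.1 p.2) +
          Z p.1 p.2 ⬝ᵥ (A p.1 *ᵥ e i) = -timeDeriv u i p.1} :=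
      (Measure.ae_prod_iff_ae_ae (measurable_swap hm)).2 hswap
    have h6 := (Measure.measurePreserving_swap (μ := leb) (ν := P)).quasiMeasurePreserving.ae h5
    filter_upwards [h6] with p hp using hp
  filter_upwards [key] with p hp h0 hT i hi
  rw [← hp i ⟨h0, hT⟩ hi, uState_eq h0 hT]

include hpos hYZ hu in
theorem ae_driver_eq (hf : ProgDriver (chainFiltration P X hX.measurable) f) :
    ∀ᵐ p : ℝ≥0 × Ω ∂(leb.prod P), 0 < p.1 → (p.1 : ℝ≥0∞) ≤ T → ∀ i : Fin N, X p.1 p.2 = e i →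
      f p.2 p.1 (u p.1 (e i)) (Z p.1 p.2) =
        -timeDeriv u i p.1 - ((A p.1)ᵀ *ᵥ uVec u p.1) i := by
  filter_upwards [hYZ.ae_driver_add hX hpos hu hf, hYZ.ae_increment_eq hX hpos hu,
    hX.ae_prod_pre_eq] with p h1 h2 h3 h0 hT i hi
  rw [hi] at h3
  rw [← h1 h0 hT i hi]
  -- Up to the shift `Z_i - u_i`, which does not depend on `k`, `Z` agrees with `𝐮` wherever `A_ki ≠
  -- 0`; the shift disappears because column `i` sums to zero.
  have h4 : ∀ k, Z p.1 p.2 k * A p.1 k i =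
      A p.1 k i * u p.1 (e k) + (Z p.1 p.2 i - u p.1 (e i)) * A p.1 k i := by
    intro k
    by_cases hk : i = k
    · rw [hk]; ring
    · rcases h2 h0 hT i k hk h3 with h5 | h5
      · rw [h5]; ring
      · rw [eq_add_of_sub_eq h5]; ring
  have h5 : Z p.1 p.2 ⬝ᵥ (A p.1 *ᵥ e i) = ((A p.1)ᵀ *ᵥ uVec u p.1) i := by
    simp only [dotProduct, mulVec_e]
    simp only [Matrix.mulVec, dotProduct, Matrix.transpose_apply, uVec]
    rw [Finset.sum_congr rfl fun k _ => h4 k, Finset.sum_add_distrib, ← Finset.mul_sum,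
      hX.rate.col_sum, mul_zero, add_zero]
  rw [h5]
  ring

omit [IsProbabilityMeasure P] in
include hu in
theorem ae_prod_markovian : ∀ᵐ p : ℝ≥0 × Ω ∂(leb.prod P), (p.1 : ℝ≥0∞) ≤ T →
    Y p.1 p.2 = u p.1 (X p.1 p.2) := by
  filter_upwards [Measure.quasiMeasurePreserving_snd.ae hu] with p hp using hp p.1

omit [IsProbabilityMeasure P] in
theorem ae_prod_fst_pos : ∀ᵐ p : ℝ≥0 × Ω ∂(leb.prod P), 0 < p.1 := by
  have : ∀ᵐ t ∂leb, 0 < t := by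
    have : ∀ᵐ t ∂leb, t ≠ 0 := by simp [ae_iff]
    filter_upwards [this] with t ht using pos_iff_ne_zero.2 ht
  exact Measure.quasiMeasurePreserving_fst.ae this

include hpos hYZ hu in
-- Along the solution the driver is already determined by time and state, so the witness ignores `y`
-- and `z`, and the dot product with `x` selects the component of the current state. Invariance of
-- `f` passes from `Z` to any other representative.
theorem isMarkovianDriver (hf : ProgDriver (chainFiltration P X hX.measurable) f)
    (hinv : InvariantDriver P X A (chainFiltration P X hX.measurable) f) :
    IsMarkovianDriver P X A (chainFiltration P X hX.measurable) T f Y Z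
      fun x t _ _ => x ⬝ᵥ fun i => -timeDeriv u i t - ((A t)ᵀ *ᵥ uVec u t) i := by
  intro Z' hZ' hZZ'
  filter_upwards [hYZ.ae_driver_eq hX hpos hu hf, hinv Z Z' hYZ.predictable hZ' hZZ',
    ae_prod_markovian hu, ae_prod_fst_pos] with p h1 h2 h3 h0 hT
  obtain ⟨i, hi⟩ := hX.mem_states p.1 p.2
  rw [← h2, h3 hT, hi, h1 h0 hT i hi]
  simp [e]

include hpos hYZ hu in
-- For the representative `uExtension T u Z` the arguments of `f'` on `{X_t = e_i}` are
-- deterministic. Since this event has positive probability, one suitable `ω` for almost every `t`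
-- removes the randomness.
theorem ae_odeField_eq (hf : ProgDriver (chainFiltration P X hX.measurable) f)
    (hinv : InvariantDriver P X A (chainFiltration P X hX.measurable) f)
    {f' : (Fin N → ℝ) → ℝ≥0 → ℝ → (Fin N → ℝ) → ℝ}
    (hf' : IsMarkovianDriver P X A (chainFiltration P X hX.measurable) T f Y Z f') :
    ∀ᵐ t : ℝ≥0 ∂leb, 0 < t → (t : ℝ≥0∞) ≤ T → ∀ i,
      odeField A f' t (uVec u t) i = timeDeriv u i t := by
  have hpred := isStronglyPredictable_uExtension (T := T) hYZ.predictable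
    (hYZ.continuousOn hX hpos hu)
  have heq := hYZ.equivM_uExtension hX hpos hu
  have h : ∀ᵐ p : ℝ≥0 × Ω ∂(leb.prod P), 0 < p.1 → (p.1 : ℝ≥0∞) ≤ T → ∀ i, X p.1 p.2 = e i →
      f' (e i) p.1 (u p.1 (e i)) (uVec u p.1) =
        -timeDeriv u i p.1 - ((A p.1)ᵀ *ᵥ uVec u p.1) i := by
    filter_upwards [hYZ.ae_driver_eq hX hpos hu hf, hinv Z _ hYZ.predictable hpred heq,
      ae_prod_markovian hu, hf' _ hpred heq] with p h1 h2 h3 h4 h0 hT i hi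
    rw [← h1 h0 hT i hi, h2]
    have h5 := h4 hT
    rw [h3 hT, hi] at h5
    simp only [uExtension, if_pos (show 0 < p.1 ∧ (p.1 : ℝ≥0∞) ≤ T from ⟨h0, hT⟩)] at h5 ⊢
    exact h5.symm
  filter_upwards [Measure.ae_ae_of_ae_prod h] with t ht h0 hT i
  obtain ⟨ω, h1, h2⟩ := ((frequently_ae_iff.2 (hpos t h0 i).ne').and_eventually ht).exists
  have h3 := h2 h0 hT i h1
  simp only [odeField, fVec, Pi.neg_apply, Pi.add_apply]
  change -(f' (e i) t (u t (e i)) (uVec u t) + _) = _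
  rw [h3]
  ring

end IsSolution

/-- No measurability of `f'` is assumed; integrability is inherited from `timeDeriv` through almost
everywhere equality. -/
theorem odeField_integral_of_incrementEq {f' : (Fin N → ℝ) → ℝ≥0 → ℝ → (Fin N → ℝ) → ℝ}
    (hae : ∀ᵐ t : ℝ≥0 ∂leb, 0 < t → (t : ℝ≥0∞) ≤ T → ∀ i,
      odeField A f' t (uVec u t) i = timeDeriv u i t) {i : Fin N} {s t : ℝ≥0} (hst : s ≤ t)
    (ht : (t : ℝ≥0∞) ≤ T) (h : IncrementEq u i s t) :
    IntegrableOn (fun r => odeField A f' r (uVec u r) i) (Set.Ioc s t) leb ∧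
      uVec u t i - uVec u s i = ∫ r in Set.Ioc s t, odeField A f' r (uVec u r) i ∂leb := by
  have h1 : ∀ᵐ r ∂leb, r ∈ Set.Ioc s t → odeField A f' r (uVec u r) i = timeDeriv u i r := by
    filter_upwards [hae] with r hr hmem
    exact hr (bot_lt_of_lt hmem.1) (le_trans (by exact_mod_cast hmem.2) ht) i
  rw [incrementEq_iff hst, ← setIntegral_congr_ae measurableSet_Ioc h1] at h
  refine ⟨h.1.congr ?_, h.2⟩
  filter_upwards [(ae_restrict_iff' measurableSet_Ioc).2 h1] with r hr using hr.symm

end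

end MarkovBSDE

theorem corollary3p3 {N : ℕ} {Ω : Type*} [mΩ : MeasurableSpace Ω] (P : Measure Ω)
    [IsProbabilityMeasure P] (X : ℝ≥0 → Ω → Fin N → ℝ) (A : ℝ≥0 → Matrix (Fin N) (Fin N) ℝ)
    (hX : MarkovBSDE.IsMarkovChain P X A)
    (hpos : ∀ t : ℝ≥0, 0 < t → ∀ i : Fin N, 0 < P {ω | X t ω = MarkovBSDE.e i})
    (T : ℝ≥0∞)
    (f : Ω → ℝ≥0 → ℝ → (Fin N → ℝ) → ℝ)
    (hf : MarkovBSDE.ProgDriver (MarkovBSDE.chainFiltration P X hX.measurable) f)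
    (hinv : MarkovBSDE.InvariantDriver P X A
      (MarkovBSDE.chainFiltration P X hX.measurable) f)
    (Y : ℝ≥0 → Ω → ℝ) (Z : ℝ≥0 → Ω → Fin N → ℝ)
    (hYZ : MarkovBSDE.IsSolution P X A
      (MarkovBSDE.chainFiltration P X hX.measurable) T f Y Z)
    (u : ℝ≥0 → (Fin N → ℝ) → ℝ) (hu : MarkovBSDE.IsMarkovianWith P X T Y u) :
    (∃ f' : (Fin N → ℝ) → ℝ≥0 → ℝ → (Fin N → ℝ) → ℝ,
      MarkovBSDE.IsMarkovianDriver P X A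
        (MarkovBSDE.chainFiltration P X hX.measurable) T f Y Z f') ∧
    ∀ f' : (Fin N → ℝ) → ℝ≥0 → ℝ → (Fin N → ℝ) → ℝ,
      MarkovBSDE.IsMarkovianDriver P X A
        (MarkovBSDE.chainFiltration P X hX.measurable) T f Y Z f' →
      (∀ s t : ℝ≥0, 0 < s → s ≤ t → (t : ℝ≥0∞) ≤ T →
        IntegrableOn (fun r => MarkovBSDE.odeField A f' r (MarkovBSDE.uVec u r))
          (Set.Ioc s t) MarkovBSDE.leb ∧
        MarkovBSDE.uVec u t - MarkovBSDE.uVec u s =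
          ∫ r in Set.Ioc s t, MarkovBSDE.odeField A f' r (MarkovBSDE.uVec u r) ∂MarkovBSDE.leb) ∧
      (∀ i : Fin N, (∀ ω, X 0 ω = MarkovBSDE.e i) → ∀ t : ℝ≥0, (t : ℝ≥0∞) ≤ T →
        IntegrableOn (fun r => MarkovBSDE.odeField A f' r (MarkovBSDE.uVec u r) i)
          (Set.Ioc 0 t) MarkovBSDE.leb ∧
        MarkovBSDE.uVec u t i - MarkovBSDE.uVec u 0 i =
          ∫ r in Set.Ioc 0 t, MarkovBSDE.odeField A f' r (MarkovBSDE.uVec u r) i ∂MarkovBSDE.leb) := by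
  refine ⟨⟨_, hYZ.isMarkovianDriver hX hpos hu hf hinv⟩, fun f' hf' => ?_⟩
  have hae := hYZ.ae_odeField_eq hX hpos hu hf hinv hf'
  refine ⟨fun s t hs hst ht => ?_, fun i hi t ht =>
    MarkovBSDE.odeField_integral_of_incrementEq hae zero_le ht
      (hYZ.incrementEq_zero hX hpos hu hi ht)⟩
  have h := fun i => MarkovBSDE.odeField_integral_of_incrementEq hae hst ht
    (hYZ.incrementEq hX hpos hu i hs hst ht)
  refine ⟨Integrable.of_eval fun i => (h i).1, ?_⟩
  ext i
  rw [Pi.sub_apply, (h i).2, eval_integral fun i => (h i).1]
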